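/- A partite $3$-uniform hypergraph $H=(A,B,C,E)$ has pairwise disjoint finite vertex classes $A=\{a_1,\dots,a_{n_1}\}$, $B=\{b_1,\dots,b_{n_2}\}$, $C=\{c_1,\dots,c_{n_3}\}$ and a set of hyperedges $E\subseteq A\times B\times C$; the degree of a vertex is the number of hyperedges incident with it. A degree sequence is a triple $D=\big((d_{1,1},\dots,d_{1,n_1}),(d_{2,1},\dots,d_{2,n_2}),(d_{3,1},\dots,d_{3,n_3})\big)$ of sequences of non-negative integers. A realization of $D$ is a partite $3$-uniform hypergraph with vertex classes of sizes $n_1,n_2,n_3$ in which $a_i$, $b_i$, $c_i$ have degrees $d_{1,i}$, $d_{2,i}$, $d_{3,i}$ for all $i$; $D$ is graphic if it has a realization. $D$ is third almost-regular if for some $k$ we have $d_{1,i}\in\{k,k-1\}$ for all $i=1,\dots,n_1$; nothing is assumed about the other two classes. **Theorem.** There is a polynomial-time algorithm that, given a third almost-regular degree sequence $D$, decides whether $D$ is graphic and, if it is, also constructs a realization of $D$ (as a list of its hyperedges). That is, there are a single program and a single polynomial $p$ such that on every third almost-regular $D$ (for all $n_1,n_2,n_3$ and all $k$) the program halts with the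 correct output in time at most $p(N)$, where $N$ is the length of $D$ written in binary. Time is measured on a random access machine with addition, subtraction and indirect addressing under the logarithmic cost criterion, where every operation costs one unit plus the number of binary digits of the numbers and addresses that it handles. -/

import Mathlib

/-! ## Partite 3-uniform hypergraphs and their degree sequences -/

/-- A sequence `(d_{1,1},…,d_{1,n₁}), (d_{2,1},…,d_{2,n₂}), (d_{3,1},…,d_{3,n₃})` of non-negative
integers, broken down by the three vertex classes `A = Fin n₁`, `B = Fin n₂`, `C = Fin n₃`. -/
structure DegreeSequence (n₁ n₂ n₃ : ℕ) where
  dA : Fin n₁ → ℕ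
  dB : Fin n₂ → ℕ
  dC : Fin n₃ → ℕ

/-- A partite 3-uniform hypergraph on the vertex classes `Fin n₁`, `Fin n₂`, `Fin n₃`, given by its
set of hyperedges; a hyperedge has exactly one vertex in each class. -/
abbrev PartiteHypergraph (n₁ n₂ n₃ : ℕ) : Type := Finset (Fin n₁ × Fin n₂ × Fin n₃)

namespace PartiteHypergraph

variable {n₁ n₂ n₃ : ℕ}

/-- The degree of a vertex of the first class: the number of hyperedges incident with it. -/
def degA (H : PartiteHypergraph n₁ n₂ n₃) (a : Fin n₁) : ℕ := (H.filter fun e => e.1 = a).card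

/-- The degree of a vertex of the second class. -/
def degB (H : PartiteHypergraph n₁ n₂ n₃) (b : Fin n₂) : ℕ := (H.filter fun e => e.2.1 = b).card

/-- The degree of a vertex of the third class. -/
def degC (H : PartiteHypergraph n₁ n₂ n₃) (c : Fin n₃) : ℕ := (H.filter fun e => e.2.2 = c).card

/-- `H` is a realization of `D`: the degrees of the vertices of `H` are the entries of `D`. -/
def IsRealization (H : PartiteHypergraph n₁ n₂ n₃) (D : DegreeSequence n₁ n₂ n₃) : Prop :=
  (∀ a, H.degA a = D.dA a) ∧ (∀ b, H.degB b = D.dB b) ∧ (∀ c, H.degC c = D.dC c)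

end PartiteHypergraph

namespace DegreeSequence

variable {n₁ n₂ n₃ : ℕ}

/-- `D` is graphic if it has a realization. -/
def Graphic (D : DegreeSequence n₁ n₂ n₃) : Prop :=
  ∃ H : PartiteHypergraph n₁ n₂ n₃, H.IsRealization D

/-- `D` is third almost-regular: for some `k`, every degree in the first class is `k` or `k - 1`
(the latter is written `d + 1 = k`, so that no truncated subtraction occurs). -/
def ThirdAlmostRegular (D : DegreeSequence n₁ n₂ n₃) : Prop :=
  ∃ k : ℕ, ∀ i, D.dA i = k ∨ D.dA i + 1 = k

/-- The length of `D` written in binary: `Nat.size d` is the number of binary digits of `d`, and one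
further symbol per entry is counted as a separator. -/
def bitLength (D : DegreeSequence n₁ n₂ n₃) : ℕ :=
  (∑ i, (Nat.size (D.dA i) + 1)) + (∑ j, (Nat.size (D.dB j) + 1))
    + ∑ k, (Nat.size (D.dC k) + 1)

end DegreeSequence

/-! ## Random access machine programs with logarithmic (bit) cost -/

namespace RAM

/-- The memory of the machine: registers `reg 0, reg 1, …` and arrays `arr 0, arr 1, …`, all holding
natural numbers. A program mentions finitely many registers and arrays by fixed indices; the cells
of an array are addressed by the contents of registers. -/
structure State where
  reg : ℕ → ℕ
  arr : ℕ → ℕ → ℕ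

/-- Overwrite one register. -/
def State.setReg (s : State) (x v : ℕ) : State :=
  { s with reg := Function.update s.reg x v }

/-- Overwrite one cell of an array. -/
def State.setArr (s : State) (a i v : ℕ) : State :=
  { s with arr := Function.update s.arr a (Function.update (s.arr a) i v) }

/-- Programs of the machine. The only arithmetic is addition and truncated subtraction. -/
inductive Prog where
  /-- do nothing -/
  | skip
  /-- `x := c` for a fixed number `c` -/
  | const (x c : ℕ)
  /-- `x := y + z` -/
  | add (x y z : ℕ)
  /-- `x := y - z`, truncated at zero -/
  | sub (x y z : ℕ)
  /-- `x := a[i]` -/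
  | load (x a i : ℕ)
  /-- `a[i] := x` -/
  | store (a i x : ℕ)
  /-- `P; Q` -/
  | seq (P Q : Prog)
  /-- `if x ≠ 0 then P else Q` -/
  | cond (x : ℕ) (P Q : Prog)
  /-- `while x ≠ 0 do P` -/
  | loop (x : ℕ) (P : Prog)

/-- `Exec P s t s'`: started in the memory `s`, the program `P` halts in the memory `s'` after
running for time `t`. Every elementary operation and every test costs one unit plus the number of
binary digits of all the numbers that it handles, array addresses included. -/
inductive Exec : Prog → State → ℕ → State → Prop where
  | skip (s : State) : Exec .skip s 1 s
  | const (x c : ℕ) (s : State) :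
      Exec (.const x c) s (1 + Nat.size c) (s.setReg x c)
  | add (x y z : ℕ) (s : State) :
      Exec (.add x y z) s (1 + Nat.size (s.reg y) + Nat.size (s.reg z))
        (s.setReg x (s.reg y + s.reg z))
  | sub (x y z : ℕ) (s : State) :
      Exec (.sub x y z) s (1 + Nat.size (s.reg y) + Nat.size (s.reg z))
        (s.setReg x (s.reg y - s.reg z))
  | load (x a i : ℕ) (s : State) :
      Exec (.load x a i) s (1 + Nat.size (s.reg i) + Nat.size (s.arr a (s.reg i)))
        (s.setReg x (s.arr a (s.reg i)))
  | store (a i x : ℕ) (s : State) :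
      Exec (.store a i x) s (1 + Nat.size (s.reg i) + Nat.size (s.reg x))
        (s.setArr a (s.reg i) (s.reg x))
  | seq {P Q : Prog} {s s' s'' : State} {t t' : ℕ} :
      Exec P s t s' → Exec Q s' t' s'' → Exec (.seq P Q) s (t + t') s''
  | condTrue {x : ℕ} {P Q : Prog} {s s' : State} {t : ℕ} :
      s.reg x ≠ 0 → Exec P s t s' → Exec (.cond x P Q) s (1 + Nat.size (s.reg x) + t) s'
  | condFalse {x : ℕ} {P Q : Prog} {s s' : State} {t : ℕ} :
      s.reg x = 0 → Exec Q s t s' → Exec (.cond x P Q) s (1 + Nat.size (s.reg x) + t) s'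
  | loopStep {x : ℕ} {P : Prog} {s s' s'' : State} {t t' : ℕ} :
      s.reg x ≠ 0 → Exec P s t s' → Exec (.loop x P) s' t' s'' →
        Exec (.loop x P) s (1 + Nat.size (s.reg x) + t + t') s''
  | loopDone {x : ℕ} {P : Prog} {s : State} :
      s.reg x = 0 → Exec (.loop x P) s (1 + Nat.size (s.reg x)) s

/-- The machine is deterministic: a program has at most one halting run from a given memory, so the
final memory and the running time are functions of the initial memory. -/
theorem Exec.deterministic {P : Prog} {s s₁ s₂ : State} {t₁ t₂ : ℕ}
    (h₁ : Exec P s t₁ s₁) (h₂ : Exec P s t₂ s₂) : t₁ = t₂ ∧ s₁ = s₂ := by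
  induction h₁ generalizing t₂ s₂ with
  | skip | const | add | sub | load | store => cases h₂; exact ⟨rfl, rfl⟩
  | seq _ _ ih ih' =>
    cases h₂ with
    | seq k k' =>
      obtain ⟨rfl, rfl⟩ := ih k
      obtain ⟨rfl, rfl⟩ := ih' k'
      exact ⟨rfl, rfl⟩
  | condTrue hx _ ih =>
    cases h₂ with
    | condTrue _ k => obtain ⟨rfl, rfl⟩ := ih k; exact ⟨rfl, rfl⟩
    | condFalse hx' _ => exact absurd hx' hx
  | condFalse hx _ ih =>
    cases h₂ with
    | condTrue hx' _ => exact absurd hx hx'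
    | condFalse _ k => obtain ⟨rfl, rfl⟩ := ih k; exact ⟨rfl, rfl⟩
  | loopStep hx _ _ ih ih' =>
    cases h₂ with
    | loopStep _ k k' =>
      obtain ⟨rfl, rfl⟩ := ih k
      obtain ⟨rfl, rfl⟩ := ih' k'
      exact ⟨rfl, rfl⟩
    | loopDone hx' => exact absurd hx' hx
  | loopDone hx =>
    cases h₂ with
    | loopStep hx' _ _ => exact absurd hx hx'
    | loopDone _ => exact ⟨rfl, rfl⟩

variable {n₁ n₂ n₃ : ℕ}

/-- The initial memory on input `D`: registers `0, 1, 2` hold the lengths `n₁, n₂, n₃`, arrays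
`0, 1, 2` hold the three sequences of degrees, and everything else is zero. -/
def input (D : DegreeSequence n₁ n₂ n₃) : State where
  reg x := if x = 0 then n₁ else if x = 1 then n₂ else if x = 2 then n₃ else 0
  arr a i :=
    if a = 0 then (if h : i < n₁ then D.dA ⟨i, h⟩ else 0)
    else if a = 1 then (if h : i < n₂ then D.dB ⟨i, h⟩ else 0)
    else if a = 2 then (if h : i < n₃ then D.dC ⟨i, h⟩ else 0)
    else 0

/-- The answer yes (register `3` is `1`). -/
def State.Accepts (s : State) : Prop := s.reg 3 = 1

/-- The answer no (register `3` is `0`). -/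
def State.Rejects (s : State) : Prop := s.reg 3 = 0

/-- The list of triples written as output: register `4` holds its length, and the triple number `e`
is `(arr 3 e, arr 4 e, arr 5 e)`. -/
def State.edgeList (s : State) : List (ℕ × ℕ × ℕ) :=
  (List.range (s.reg 4)).map fun e => (s.arr 3 e, s.arr 4 e, s.arr 5 e)

/-- The output is a list of all the hyperedges of `H`, each of them listed exactly once. -/
def State.Outputs (s : State) (H : PartiteHypergraph n₁ n₂ n₃) : Prop :=
  s.edgeList.Nodup ∧
    ∀ x y z : ℕ, (x, y, z) ∈ s.edgeList ↔
      ∃ (hx : x < n₁) (hy : y < n₂) (hz : z < n₃),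
        ((⟨x, hx⟩, ⟨y, hy⟩, ⟨z, hz⟩) : Fin n₁ × Fin n₂ × Fin n₃) ∈ H

end RAM

/-!
The numbers of hyperedges through the pairs `(b, c)` of a realization form a matrix with entries at
most `n₁` whose row and column sums are the degrees in the second and third class. Conversely, let
any such matrix be given. A realization with these codegrees is a 0-1 matrix with the pairs `(b, c)`
as rows and the first class as columns, whose row sums are the codegrees and whose column sums are
the degrees in the first class. Since the latter differ by at most one, it always exists: in a 0-1
matrix with the right row sums, a unit can be moved within some row from a column with too many
units to a column with too few. Hence `D` is graphic if and only if a matrix of codegrees exists,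
and any choice of it can be continued.

Both matrices are found by the same greedy algorithm. It treats the rows one after the other and
puts each unit of a row into a column with room that lacks most; an exchange argument shows that
this never spoils a solution.

Every loop makes at most `N ^ 2 + 1` rounds, where `N` is the length of the input. So the number of
steps is polynomial, and as a step lengthens the longest number in the memory by at most one digit,
the logarithmic cost is polynomial as well.
-/

open Finset Matrix

/-! ## Matrices with bounded entries and prescribed row and column sums -/

section Transport

variable {ι κ : Type*} {s : Finset ι} {t : Finset κ} {q : ℕ} {row : ι → ℕ} {col : κ → ℕ}
  {M m : Matrix ι κ ℕ}

/-- On the index set `s × t`, the matrix `M` has entries at most `q` and row sums `row`. -/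
structure HasRowSums (s : Finset ι) (t : Finset κ) (q : ℕ) (row : ι → ℕ) (M : Matrix ι κ ℕ) :
    Prop where
  le : ∀ i ∈ s, ∀ j ∈ t, M i j ≤ q
  row_sum : ∀ i ∈ s, ∑ j ∈ t, M i j = row i

/-- On the index set `s × t`, the matrix `M` has entries at most `q`, row sums `row` and column
sums `col`. -/
structure IsTransport (s : Finset ι) (t : Finset κ) (q : ℕ) (row : ι → ℕ) (col : κ → ℕ)
    (M : Matrix ι κ ℕ) : Prop extends HasRowSums s t q row M where
  col_sum : ∀ j ∈ t, ∑ i ∈ s, M i j = col j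

section MoveUnit

variable [DecidableEq ι] [DecidableEq κ] {i e : ι} {c d j k : κ}

theorem sum_single_row (hj : j ∈ t) (i x : ι) :
    ∑ y ∈ t, single i j 1 x y = if i = x then 1 else 0 := by
  by_cases hx : i = x <;> simp [single_apply, hx, hj]

theorem sum_single_col (hi : i ∈ s) (j y : κ) :
    ∑ x ∈ s, single i j 1 x y = if j = y then 1 else 0 := by
  by_cases hy : j = y <;> simp [single_apply, hy, hi]

/-- `M` with one unit moved within row `i`, from column `j` to column `k`. -/
def moveUnit (M : Matrix ι κ ℕ) (i : ι) (j k : κ) : Matrix ι κ ℕ := M - single i j 1 + single i k 1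

theorem moveUnit_apply_add (h : 0 < M i j) (k : κ) (x : ι) (y : κ) :
    moveUnit M i j k x y + single i j 1 x y = M x y + single i k 1 x y := by
  have hle : single i j 1 x y ≤ M x y := by
    rw [single_apply]
    split_ifs with hxy
    · rwa [← hxy.1, ← hxy.2]
    · exact Nat.zero_le _
  rw [moveUnit, Matrix.add_apply, Matrix.sub_apply]
  omega

theorem hasRowSums_moveUnit (hM : HasRowSums s t q row M) (hj : j ∈ t) (hk : k ∈ t)
    (h : 0 < M i j) (hlt : M i k < q) : HasRowSums s t q row (moveUnit M i j k) := by
  refine ⟨fun x hx y hy => ?_, fun x hx => ?_⟩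
  · have hadd := moveUnit_apply_add h k x y
    have hle := hM.le x hx y hy
    rw [single_apply i k] at hadd
    split_ifs at hadd with hxy
    · rw [← hxy.1, ← hxy.2] at hadd hle ⊢
      omega
    · omega
  · have hsum := sum_congr (rfl : t = t) fun y _ => moveUnit_apply_add h k x y
    rw [sum_add_distrib, sum_add_distrib, sum_single_row hj, sum_single_row hk,
      hM.row_sum x hx] at hsum
    exact Nat.add_right_cancel hsum

theorem sum_col_moveUnit (hi : i ∈ s) (h : 0 < M i j) (k y : κ) :
    ∑ x ∈ s, moveUnit M i j k x y + (if j = y then 1 else 0)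
      = ∑ x ∈ s, M x y + (if k = y then 1 else 0) := by
  have hsum := sum_congr (rfl : s = s) fun x _ => moveUnit_apply_add h k x y
  rwa [sum_add_distrib, sum_add_distrib, sum_single_col hi, sum_single_col hi] at hsum

theorem IsTransport.exists_swap (hM : IsTransport s t q row col M) (hi : i ∈ s) (he : e ∈ s)
    (hie : i ≠ e) (hc : c ∈ t) (hd : d ∈ t) (hid : 0 < M i d) (hic : M i c < q) (hec : 0 < M e c)
    (hed : M e d < q) :
    ∃ M', IsTransport s t q row col M' ∧ ∀ x y, M' x y + single i d 1 x y + single e c 1 x y =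
      M x y + single i c 1 x y + single e d 1 x y := by
  have hrow_e : ∀ y, moveUnit M i d c e y = M e y := fun y => by
    simp [moveUnit, hie]
  have hec' : 0 < moveUnit M i d c e c := by rwa [hrow_e]
  have hrows := hasRowSums_moveUnit (hasRowSums_moveUnit hM.toHasRowSums hd hc hid hic) hc hd hec'
    (by rwa [hrow_e])
  refine ⟨_, ⟨hrows, fun y hy => ?_⟩, fun x y => ?_⟩
  · have h₁ := sum_col_moveUnit hi hid c y
    have h₂ := sum_col_moveUnit he hec' d y
    rw [← hM.col_sum y hy]
    omega
  · have h₁ := moveUnit_apply_add hid c x y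
    have h₂ := moveUnit_apply_add hec' d x y
    omega

end MoveUnit

/-! ### Almost constant column sums -/

/-- The number of units that the columns of `M` lack in total. -/
def deficiency (s : Finset ι) (t : Finset κ) (col : κ → ℕ) (M : Matrix ι κ ℕ) : ℕ :=
  ∑ j ∈ t, (col j - ∑ i ∈ s, M i j)

theorem HasRowSums.sum_col_sum (hM : HasRowSums s t q row M) :
    ∑ j ∈ t, ∑ i ∈ s, M i j = ∑ i ∈ s, row i := by
  rw [sum_comm]
  exact sum_congr rfl hM.row_sum

theorem HasRowSums.isTransport_of_deficiency_eq_zero (hM : HasRowSums s t q row M)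
    (hsum : ∑ i ∈ s, row i = ∑ j ∈ t, col j) (h0 : deficiency s t col M = 0) :
    IsTransport s t q row col M := by
  have hle : ∀ j ∈ t, col j ≤ ∑ i ∈ s, M i j := fun j hj =>
    tsub_eq_zero_iff_le.1 (sum_eq_zero_iff.1 h0 j hj)
  have heq := (sum_eq_sum_iff_of_le hle).1 (hsum.symm.trans hM.sum_col_sum.symm)
  exact ⟨hM, fun j hj => (heq j hj).symm⟩

/-- Some column `a` has a unit too many and some column `b` lacks one. Since the prescribed sums
differ by at most one, column `a` outweighs column `b`, hence does so in some row, and a unit can be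
moved from `a` to `b` in that row. -/
theorem HasRowSums.exists_deficiency_lt (hM : HasRowSums s t q row M)
    (hcol : ∀ a ∈ t, ∀ b ∈ t, col a ≤ col b + 1)
    (hsum : ∑ i ∈ s, row i = ∑ j ∈ t, col j) (h0 : deficiency s t col M ≠ 0) :
    ∃ M', HasRowSums s t q row M' ∧ deficiency s t col M' < deficiency s t col M := by
  classical
  obtain ⟨b, hb, hdef⟩ := exists_ne_zero_of_sum_ne_zero h0
  have hlack : ∑ i ∈ s, M i b < col b := by omega
  obtain ⟨a, ha, hexcess⟩ : ∃ a ∈ t, col a < ∑ i ∈ s, M i a := by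
    by_contra! hcon
    have hlt := sum_lt_sum hcon ⟨b, hb, hlack⟩
    rw [hM.sum_col_sum] at hlt
    omega
  have hab : a ≠ b := by
    rintro rfl
    omega
  obtain ⟨i, hi, hlt⟩ : ∃ i ∈ s, M i b < M i a := by
    refine exists_lt_of_sum_lt ?_
    have := hcol b hb a ha
    omega
  have hpos : 0 < M i a := by omega
  have hcols := fun y => sum_col_moveUnit hi hpos b y
  refine ⟨moveUnit M i a b, hasRowSums_moveUnit hM ha hb hpos (hlt.trans_le (hM.le i hi a ha)),
    sum_lt_sum (fun y _ => ?_) ⟨b, hb, ?_⟩⟩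
  · have := hcols y
    rcases eq_or_ne a y with rfl | hay
    · rw [if_pos rfl] at this
      split_ifs at this <;> omega
    · rw [if_neg hay] at this
      omega
  · have := hcols b
    rw [if_neg hab, if_pos rfl] at this
    omega

theorem exists_forall_le_and_sum_eq (t : Finset κ) {q r : ℕ} (h : r ≤ #t * q) :
    ∃ f : κ → ℕ, (∀ j, f j ≤ q) ∧ ∑ j ∈ t, f j = r := by
  induction t using Finset.cons_induction generalizing r with
  | empty => exact ⟨0, fun _ => Nat.zero_le q, by simp_all⟩
  | cons a t ha ih =>
    classical
    rw [card_cons, add_one_mul] at h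
    obtain ⟨f, hf, hsum⟩ := ih (r := r - min r q) (by omega)
    refine ⟨Function.update f a (min r q), fun j => ?_, ?_⟩
    · rw [Function.update_apply]
      split_ifs
      exacts [min_le_right r q, hf j]
    · rw [sum_cons, Function.update_self, sum_update_of_notMem ha, hsum]
      omega

theorem exists_hasRowSums (hrow : ∀ i ∈ s, row i ≤ #t * q) : ∃ M, HasRowSums s t q row M := by
  classical
  choose! f hf hsum using fun i (hi : i ∈ s) => exists_forall_le_and_sum_eq t (hrow i hi)
  exact ⟨of f, fun i hi j _ => hf i hi j, hsum⟩

theorem exists_isTransport (hrow : ∀ i ∈ s, row i ≤ #t * q)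
    (hcol : ∀ a ∈ t, ∀ b ∈ t, col a ≤ col b + 1) (hsum : ∑ i ∈ s, row i = ∑ j ∈ t, col j) :
    ∃ M, IsTransport s t q row col M := by
  obtain ⟨M, hM⟩ := exists_hasRowSums hrow
  induction hn : deficiency s t col M using Nat.strong_induction_on generalizing M with
  | _ n ih =>
    rcases eq_or_ne n 0 with rfl | hn0
    · exact ⟨M, hM.isTransport_of_deficiency_eq_zero hsum hn⟩
    · subst hn
      obtain ⟨M', hM', hlt⟩ := hM.exists_deficiency_lt hcol hsum hn0
      exact ih _ hlt M' hM' rfl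

/-! ### Partial solutions -/

/-- `m` is a partial solution of a transport problem: `rowRem` and `colRem` are what its row and
column sums lack. -/
structure IsPartialTransport (s : Finset ι) (t : Finset κ) (q : ℕ) (row : ι → ℕ) (col : κ → ℕ)
    (m : Matrix ι κ ℕ) (rowRem : ι → ℕ) (colRem : κ → ℕ) : Prop where
  le : ∀ i ∈ s, ∀ j ∈ t, m i j ≤ q
  row_sum : ∀ i ∈ s, rowRem i + ∑ j ∈ t, m i j = row i
  col_sum : ∀ j ∈ t, colRem j + ∑ i ∈ s, m i j = col j

/-- The matrix `m` can be completed to a solution of the transport problem. -/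
def IsExtendable (s : Finset ι) (t : Finset κ) (q : ℕ) (row : ι → ℕ) (col : κ → ℕ)
    (m : Matrix ι κ ℕ) : Prop :=
  ∃ M, IsTransport s t q row col M ∧ ∀ i ∈ s, ∀ j ∈ t, m i j ≤ M i j

namespace IsPartialTransport

variable {rowRem : ι → ℕ} {colRem : κ → ℕ} {i : ι} {c d : κ}

theorem zero (s : Finset ι) (t : Finset κ) (q : ℕ) (row : ι → ℕ) (col : κ → ℕ) :
    IsPartialTransport s t q row col 0 row col :=
  ⟨by simp, by simp, by simp⟩

theorem isTransport (h : IsPartialTransport s t q row col m rowRem colRem)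
    (hrow : ∀ i ∈ s, rowRem i = 0) (hcol : ∀ j ∈ t, colRem j = 0) :
    IsTransport s t q row col m where
  le := h.le
  row_sum i hi := by rw [← h.row_sum i hi, hrow i hi, zero_add]
  col_sum j hj := by rw [← h.col_sum j hj, hcol j hj, zero_add]

theorem eq_of_rowRem_eq_zero (h : IsPartialTransport s t q row col m rowRem colRem)
    (hM : IsTransport s t q row col M) (hle : ∀ i ∈ s, ∀ j ∈ t, m i j ≤ M i j) (hi : i ∈ s)
    (h0 : rowRem i = 0) : ∀ j ∈ t, m i j = M i j := by
  have hsum := h.row_sum i hi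
  rw [h0, zero_add, ← hM.row_sum i hi] at hsum
  exact (sum_eq_sum_iff_of_le (hle i hi)).1 hsum

theorem colRem_eq_sum_sub (h : IsPartialTransport s t q row col m rowRem colRem)
    (hM : IsTransport s t q row col M) (hle : ∀ i ∈ s, ∀ j ∈ t, m i j ≤ M i j) (hc : c ∈ t) :
    colRem c = ∑ i ∈ s, (M i c - m i c) := by
  rw [sum_tsub_distrib s fun i hi => hle i hi c hc, hM.col_sum c hc, ← h.col_sum c hc,
    add_tsub_cancel_right]

theorem exists_lt_of_rowRem_ne_zero (h : IsPartialTransport s t q row col m rowRem colRem)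
    (hM : IsTransport s t q row col M) (hi : i ∈ s) (h0 : rowRem i ≠ 0) :
    ∃ j ∈ t, m i j < M i j := by
  refine exists_lt_of_sum_lt ?_
  rw [hM.row_sum i hi, ← h.row_sum i hi]
  omega

theorem exists_room (h : IsPartialTransport s t q row col m rowRem colRem)
    (hext : IsExtendable s t q row col m) (hi : i ∈ s) (h0 : rowRem i ≠ 0) :
    ∃ j ∈ t, m i j < q ∧ colRem j ≠ 0 := by
  obtain ⟨M, hM, hle⟩ := hext
  obtain ⟨j, hj, hlt⟩ := h.exists_lt_of_rowRem_ne_zero hM hi h0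
  refine ⟨j, hj, hlt.trans_le (hM.le i hi j hj), fun hcol => ?_⟩
  rw [h.colRem_eq_sum_sub hM hle hj, sum_eq_zero_iff] at hcol
  have := hcol i hi
  omega

theorem colRem_eq_zero (h : IsPartialTransport s t q row col m rowRem colRem)
    (hext : IsExtendable s t q row col m) (hrow : ∀ i ∈ s, rowRem i = 0) :
    ∀ j ∈ t, colRem j = 0 := by
  obtain ⟨M, hM, hle⟩ := hext
  intro j hj
  rw [h.colRem_eq_sum_sub hM hle hj]
  refine sum_eq_zero fun i hi => ?_
  rw [h.eq_of_rowRem_eq_zero hM hle hi (hrow i hi) j hj, tsub_self]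

theorem exists_empty_row_lt (h : IsPartialTransport s t q row col m rowRem colRem)
    (hM : IsTransport s t q row col M) (hle : ∀ x ∈ s, ∀ y ∈ t, m x y ≤ M x y)
    (hrows : ∀ x ∈ s, x ≠ i → rowRem x = 0 ∨ ∀ y ∈ t, m x y = 0)
    (hi : i ∈ s) (hc : c ∈ t) (hd : d ∈ t) (hic : m i c = M i c) (hid : m i d < M i d)
    (hdc : colRem d ≤ colRem c) :
    ∃ e ∈ s, e ≠ i ∧ (∀ y ∈ t, m e y = 0) ∧ M e d < M e c := by
  rw [h.colRem_eq_sum_sub hM hle hd, h.colRem_eq_sum_sub hM hle hc] at hdc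
  obtain ⟨e, he, hlt⟩ : ∃ e ∈ s, M e d - m e d < M e c - m e c := by
    by_contra! hcon
    have := sum_lt_sum hcon ⟨i, hi, by omega⟩
    omega
  have hei : e ≠ i := by
    rintro rfl
    omega
  have hempty : ∀ y ∈ t, m e y = 0 := by
    refine (hrows e he hei).resolve_left fun hfull => ?_
    have := h.eq_of_rowRem_eq_zero hM hle he hfull c hc
    omega
  rw [hempty c hc, hempty d hd] at hlt
  exact ⟨e, he, hei, hempty, hlt⟩

/-- The exchange argument behind the greedy algorithm: if a completion of `m` has no further unit
in row `i` and column `c`, it has one in row `i` and some column `d`. As column `c` lacks at least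
as much as column `d`, some row `e` makes up for the difference, and these units can be swapped. -/
theorem exists_extension_lt
    (h : IsPartialTransport s t q row col m rowRem colRem) (hext : IsExtendable s t q row col m)
    (hrows : ∀ x ∈ s, x ≠ i → rowRem x = 0 ∨ ∀ y ∈ t, m x y = 0)
    (hi : i ∈ s) (hc : c ∈ t) (h0 : rowRem i ≠ 0) (hroom : m i c < q)
    (hmax : ∀ y ∈ t, m i y < q → colRem y ≤ colRem c) :
    ∃ M, IsTransport s t q row col M ∧ (∀ x ∈ s, ∀ y ∈ t, m x y ≤ M x y) ∧ m i c < M i c := by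
  classical
  obtain ⟨M, hM, hle⟩ := hext
  rcases (hle i hi c hc).lt_or_eq with hlt | hic
  · exact ⟨M, hM, hle, hlt⟩
  obtain ⟨d, hd, hid⟩ := h.exists_lt_of_rowRem_ne_zero hM hi h0
  have hcd : c ≠ d := by
    rintro rfl
    omega
  obtain ⟨e, he, hei, hempty, hlt⟩ := h.exists_empty_row_lt hM hle hrows hi hc hd hic hid
    (hmax d hd (hid.trans_le (hM.le i hi d hd)))
  obtain ⟨M', hM', hswap⟩ := hM.exists_swap hi he hei.symm hc hd (Nat.zero_lt_of_lt hid)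
    (hic ▸ hroom) (Nat.zero_lt_of_lt hlt) (hlt.trans_le (hM.le e he c hc))
  refine ⟨M', hM', fun x hx y hy => ?_, ?_⟩
  · rcases eq_or_ne e x with rfl | hex
    · exact (hempty y hy).trans_le (Nat.zero_le _)
    have hxy := hswap x y
    have hlexy := hle x hx y hy
    rw [single_apply_of_row_ne hex, single_apply_of_row_ne hex] at hxy
    by_cases hdxy : i = x ∧ d = y
    · obtain ⟨rfl, rfl⟩ := hdxy
      rw [single_apply_same] at hxy
      omega
    · rw [single_apply_of_ne _ _ _ _ _ hdxy] at hxy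
      omega
  · have hswap_ic := hswap i c
    rw [single_apply_same, single_apply_of_row_ne hei, single_apply_of_row_ne hei,
      single_apply_of_col_ne _ _ hcd.symm] at hswap_ic
    omega

theorem add_single [DecidableEq ι] [DecidableEq κ] {m' : Matrix ι κ ℕ}
    (h : IsPartialTransport s t q row col m rowRem colRem) (hi : i ∈ s) (hc : c ∈ t)
    (hrow : rowRem i ≠ 0) (hcol : colRem c ≠ 0) (hroom : m i c < q)
    (hm' : ∀ x ∈ s, ∀ y ∈ t, m' x y = m x y + single i c 1 x y) :
    IsPartialTransport s t q row col m' (Function.update rowRem i (rowRem i - 1))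
      (Function.update colRem c (colRem c - 1)) := by
  refine ⟨fun x hx y hy => ?_, fun x hx => ?_, fun y hy => ?_⟩
  · rw [hm' x hx y hy, single_apply]
    split_ifs with hxy
    · rwa [← hxy.1, ← hxy.2]
    · exact h.le x hx y hy
  · rw [sum_congr rfl (hm' x hx), sum_add_distrib, sum_single_row hc, ← h.row_sum x hx]
    rcases eq_or_ne x i with rfl | hne
    · rw [Function.update_self, if_pos rfl]
      omega
    · rw [Function.update_of_ne hne, if_neg hne.symm, add_zero]
  · rw [sum_congr rfl fun x hx => hm' x hx y hy, sum_add_distrib, sum_single_col hi,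
      ← h.col_sum y hy]
    rcases eq_or_ne y c with rfl | hne
    · rw [Function.update_self, if_pos rfl]
      omega
    · rw [Function.update_of_ne hne, if_neg hne.symm, add_zero]

end IsPartialTransport

end Transport

/-! ## The greedy algorithm -/

theorem mul_add_div_of_lt {C y : ℕ} (x : ℕ) (hy : y < C) : (x * C + y) / C = x := by
  rw [Nat.mul_comm, Nat.mul_add_div (Nat.zero_lt_of_lt hy), Nat.div_eq_of_lt hy, add_zero]

theorem mul_add_inj {C x y x' y' : ℕ} (hy : y < C) (hy' : y' < C)
    (h : x * C + y = x' * C + y') : x = x' ∧ y = y' :=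
  ⟨by rw [← mul_add_div_of_lt x hy, h, mul_add_div_of_lt x' hy'],
    by rw [← Nat.mul_add_mod_of_lt hy, h, Nat.mul_add_mod_of_lt hy']⟩

theorem mul_add_lt_mul_of_lt {C R x y : ℕ} (hx : x < R) (hy : y < C) : x * C + y < R * C := by
  rw [mul_comm x]
  exact Nat.mul_add_lt_mul_of_lt_of_lt hx hy

/-- The matrix with `C` columns that is stored row by row in the sequence `out`. -/
def rowMajor (C : ℕ) (out : ℕ → ℕ) : Matrix ℕ ℕ ℕ := of fun x y => out (x * C + y)

theorem rowMajor_update_add_one {C i c x y : ℕ} (hc : c < C) (hy : y < C) (out : ℕ → ℕ) :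
    rowMajor C (Function.update out (i * C + c) (out (i * C + c) + 1)) x y
      = rowMajor C out x y + single i c 1 x y := by
  simp only [rowMajor, of_apply, single_apply, Function.update_apply]
  split_ifs with hpos hxy hxy
  · rw [hpos]
  · obtain ⟨rfl, rfl⟩ := mul_add_inj hy hc hpos
    simp at hxy
  · obtain ⟨rfl, rfl⟩ := hxy
    exact absurd rfl hpos
  · rfl

/-- The greedy algorithm fills an `R × C` matrix row by row and tries `C * q` times to put a unit
into each row, into a column with room that lacks most. This is its state while it works on row `i`
and has made `u` tries: `out` holds the matrix, `rowRem` and `colRem` what the rows and columns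
lack. -/
structure GreedyInv (R C q : ℕ) (row col : ℕ → ℕ) (i u : ℕ) (out rowRem colRem : ℕ → ℕ) :
    Prop where
  isPartial : IsPartialTransport (range R) (range C) q row col (rowMajor C out) rowRem colRem
  empty : ∀ x, i < x → ∀ y < C, rowMajor C out x y = 0
  extendable : (∃ M, IsTransport (range R) (range C) q row col M) →
    IsExtendable (range R) (range C) q row col (rowMajor C out)
  rowRem_eq_zero : (∃ M, IsTransport (range R) (range C) q row col M) → ∀ x < i, rowRem x = 0
  rowRem_le : (∃ M, IsTransport (range R) (range C) q row col M) → i < R → rowRem i + u ≤ C * q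

theorem IsPartialTransport.rowRem_le {R C q i : ℕ} {row col rowRem colRem : ℕ → ℕ}
    {m : Matrix ℕ ℕ ℕ}
    (h : IsPartialTransport (range R) (range C) q row col m rowRem colRem)
    (hsol : ∃ M, IsTransport (range R) (range C) q row col M) (hi : i < R) :
    rowRem i ≤ C * q := by
  obtain ⟨M, hM⟩ := hsol
  rw [← mem_range] at hi
  calc rowRem i ≤ row i := h.row_sum i hi ▸ Nat.le_add_right ..
    _ = ∑ j ∈ range C, M i j := (hM.row_sum i hi).symm
    _ ≤ C * q := by simpa using sum_le_card_nsmul (range C) (M i) q (hM.le i hi)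

namespace GreedyInv

variable {R C q i u c : ℕ} {row col out rowRem colRem : ℕ → ℕ}

theorem zero (R C q : ℕ) (row col : ℕ → ℕ) : GreedyInv R C q row col 0 0 0 row col where
  isPartial := .zero ..
  empty _ _ _ _ := rfl
  extendable := fun ⟨M, hM⟩ => ⟨M, hM, fun _ _ _ _ => Nat.zero_le _⟩
  rowRem_eq_zero _ x hx := absurd hx (Nat.not_lt_zero x)
  rowRem_le := (IsPartialTransport.zero ..).rowRem_le

theorem place (h : GreedyInv R C q row col i u out rowRem colRem) (hi : i < R) (hc : c < C)
    (hrow : rowRem i ≠ 0) (hcol : colRem c ≠ 0) (hroom : rowMajor C out i c < q)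
    (hmax : ∀ y < C, rowMajor C out i y < q → colRem y ≤ colRem c) :
    GreedyInv R C q row col i (u + 1) (Function.update out (i * C + c) (out (i * C + c) + 1))
      (Function.update rowRem i (rowRem i - 1)) (Function.update colRem c (colRem c - 1)) := by
  have hadd : ∀ x, ∀ y < C, rowMajor C (Function.update out (i * C + c) (out (i * C + c) + 1)) x y
      = rowMajor C out x y + single i c 1 x y := fun x y hy => rowMajor_update_add_one hc hy out
  refine ⟨?_, fun x hx y hy => ?_, fun hsol => ?_, fun hsol x hx => ?_, fun hsol _ => ?_⟩
  · exact h.isPartial.add_single (mem_range.2 hi) (mem_range.2 hc) hrow hcol hroom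
      fun x _ y hy => hadd x y (mem_range.1 hy)
  · rw [hadd x y hy, h.empty x hx y hy, single_apply_of_row_ne hx.ne, add_zero]
  · have hrows : ∀ x ∈ range R, x ≠ i → rowRem x = 0 ∨ ∀ y ∈ range C, rowMajor C out x y = 0 := by
      intro x _ hxi
      rcases hxi.lt_or_gt with hlt | hgt
      · exact .inl (h.rowRem_eq_zero hsol x hlt)
      · exact .inr fun y hy => h.empty x hgt y (mem_range.1 hy)
    obtain ⟨M, hM, hle, hlt⟩ := h.isPartial.exists_extension_lt (h.extendable hsol) hrows
      (mem_range.2 hi) (mem_range.2 hc) hrow hroom fun y hy => hmax y (mem_range.1 hy)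
    refine ⟨M, hM, fun x hx y hy => ?_⟩
    rw [hadd x y (mem_range.1 hy), single_apply]
    split_ifs with hxy
    · rwa [← hxy.1, ← hxy.2]
    · exact hle x hx y hy
  · rw [Function.update_of_ne hx.ne, h.rowRem_eq_zero hsol x hx]
  · have := h.rowRem_le hsol hi
    rw [Function.update_self]
    omega

theorem idle (h : GreedyInv R C q row col i u out rowRem colRem) (hu : u < C * q)
    (hstuck : rowRem i = 0 ∨ ∀ y < C, rowMajor C out i y < q → colRem y = 0) :
    GreedyInv R C q row col i (u + 1) out rowRem colRem := by
  refine { h with rowRem_le := fun hsol hi => ?_ }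
  have h0 : rowRem i = 0 := by
    by_contra h0
    obtain ⟨y, hy, hroom, hcol⟩ := h.isPartial.exists_room (h.extendable hsol) (mem_range.2 hi) h0
    exact hcol (hstuck.resolve_left h0 y (mem_range.1 hy) hroom)
  omega

theorem next (h : GreedyInv R C q row col i (C * q) out rowRem colRem) (hi : i < R) :
    GreedyInv R C q row col (i + 1) 0 out rowRem colRem where
  isPartial := h.isPartial
  empty x hx := h.empty x (Nat.lt_of_succ_lt hx)
  extendable := h.extendable
  rowRem_eq_zero hsol x hx := by
    rcases Nat.lt_succ_iff_lt_or_eq.1 hx with hlt | rfl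
    · exact h.rowRem_eq_zero hsol x hlt
    · have := h.rowRem_le hsol hi
      omega
  rowRem_le := h.isPartial.rowRem_le

theorem isTransport_of_sum_eq_zero (h : GreedyInv R C q row col i u out rowRem colRem)
    (h0 : ∑ x ∈ range R, rowRem x + ∑ y ∈ range C, colRem y = 0) :
    IsTransport (range R) (range C) q row col (rowMajor C out) := by
  obtain ⟨hrow, hcol⟩ := Nat.add_eq_zero_iff.1 h0
  exact h.isPartial.isTransport (sum_eq_zero_iff.1 hrow) (sum_eq_zero_iff.1 hcol)

theorem sum_eq_zero_of_exists (h : GreedyInv R C q row col R u out rowRem colRem)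
    (hsol : ∃ M, IsTransport (range R) (range C) q row col M) :
    ∑ x ∈ range R, rowRem x + ∑ y ∈ range C, colRem y = 0 := by
  have hrow : ∀ x ∈ range R, rowRem x = 0 := fun x hx =>
    h.rowRem_eq_zero hsol x (mem_range.1 hx)
  have hcol := h.isPartial.colRem_eq_zero (h.extendable hsol) hrow
  rw [sum_eq_zero hrow, sum_eq_zero hcol, add_zero]

end GreedyInv

/-! ## Realizations as pairs of matrices -/

theorem sum_range_mul {M : Type*} [AddCommMonoid M] (f : ℕ → M) (R C : ℕ) :
    ∑ p ∈ range (R * C), f p = ∑ x ∈ range R, ∑ y ∈ range C, f (x * C + y) := by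
  induction R with
  | zero => simp
  | succ R ih => rw [add_one_mul, sum_range_add, ih, sum_range_succ]

/-- The sequence `d` of length `n`, continued by zeros. This is how sequences are stored in arrays
of the machine. -/
def extendZero {n : ℕ} (d : Fin n → ℕ) (i : ℕ) : ℕ := if h : i < n then d ⟨i, h⟩ else 0

theorem extendZero_val {n : ℕ} (d : Fin n → ℕ) (i : Fin n) : extendZero d i = d i := by
  simp [extendZero]

theorem sum_extendZero {n : ℕ} (d : Fin n → ℕ) : ∑ i ∈ range n, extendZero d i = ∑ i, d i := by
  simp only [sum_range, extendZero_val]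

theorem isTransport_range {R C q : ℕ} {row : Fin R → ℕ} {col : Fin C → ℕ} {M : Matrix ℕ ℕ ℕ} :
    IsTransport (range R) (range C) q (extendZero row) (extendZero col) M ↔
      IsTransport univ univ q row col (M.submatrix Fin.val Fin.val) := by
  refine ⟨fun h => ⟨⟨fun i _ j _ => ?_, fun i _ => ?_⟩, fun j _ => ?_⟩,
    fun h => ⟨⟨fun i hi j hj => ?_, fun i hi => ?_⟩, fun j hj => ?_⟩⟩
  · exact h.le i (mem_range.2 i.2) j (mem_range.2 j.2)
  · rw [← extendZero_val row, ← h.row_sum i (mem_range.2 i.2), sum_range]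
    rfl
  · rw [← extendZero_val col, ← h.col_sum j (mem_range.2 j.2), sum_range]
    rfl
  · lift i to Fin R using mem_range.1 hi
    lift j to Fin C using mem_range.1 hj
    exact h.le i (mem_univ i) j (mem_univ j)
  · lift i to Fin R using mem_range.1 hi
    rw [extendZero_val, ← h.row_sum i (mem_univ i), sum_range]
    rfl
  · lift j to Fin C using mem_range.1 hj
    rw [extendZero_val, ← h.col_sum j (mem_univ j), sum_range]
    rfl

theorem IsTransport.exists_isTransport_range {R C q : ℕ} {row : Fin R → ℕ} {col : Fin C → ℕ}
    {M : Matrix (Fin R) (Fin C) ℕ} (hM : IsTransport univ univ q row col M) :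
    ∃ M', IsTransport (range R) (range C) q (extendZero row) (extendZero col) M' := by
  refine ⟨of fun x y => extendZero (fun i => extendZero (M i) y) x, isTransport_range.2 ?_⟩
  convert hM
  ext i j
  simp only [submatrix_apply, of_apply, extendZero_val]

namespace PartiteHypergraph

variable {n₁ n₂ n₃ : ℕ} {D : DegreeSequence n₁ n₂ n₃} {H : PartiteHypergraph n₁ n₂ n₃}

theorem card_filter_eq_sum (H : PartiteHypergraph n₁ n₂ n₃)
    (p : Fin n₁ × Fin n₂ × Fin n₃ → Prop) [DecidablePred p] :
    #(H.filter p) = ∑ a, ∑ b, ∑ c, if p (a, b, c) ∧ (a, b, c) ∈ H then 1 else 0 := by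
  have hfilter : H.filter p = univ.filter fun e => p e ∧ e ∈ H := by
    ext
    simp [and_comm]
  simp only [hfilter, card_filter, Fintype.sum_prod_type]

theorem degA_eq_sum (H : PartiteHypergraph n₁ n₂ n₃) (a : Fin n₁) :
    H.degA a = ∑ b, ∑ c, if (a, b, c) ∈ H then 1 else 0 := by
  rw [degA, card_filter_eq_sum, sum_eq_single a (fun x _ hx => by simp [hx]) (by simp)]
  simp only [true_and]

theorem degB_eq_sum (H : PartiteHypergraph n₁ n₂ n₃) (b : Fin n₂) :
    H.degB b = ∑ c, ∑ a, if (a, b, c) ∈ H then 1 else 0 := by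
  rw [degB, card_filter_eq_sum, sum_comm, sum_eq_single b (fun x _ hx => by simp [hx]) (by simp),
    sum_comm]
  simp only [true_and]

theorem degC_eq_sum (H : PartiteHypergraph n₁ n₂ n₃) (c : Fin n₃) :
    H.degC c = ∑ b, ∑ a, if (a, b, c) ∈ H then 1 else 0 := by
  rw [degC, card_filter_eq_sum, sum_comm]
  refine sum_congr rfl fun b _ => sum_congr rfl fun a _ => ?_
  rw [sum_eq_single c (fun x _ hx => by simp [hx]) (by simp)]
  simp only [true_and]

theorem sum_degA (H : PartiteHypergraph n₁ n₂ n₃) : ∑ a, H.degA a = #H :=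
  (card_eq_sum_card_fiberwise fun e _ => mem_univ e.1).symm

theorem sum_degB (H : PartiteHypergraph n₁ n₂ n₃) : ∑ b, H.degB b = #H :=
  (card_eq_sum_card_fiberwise fun e _ => mem_univ e.2.1).symm

/-- The numbers of hyperedges that contain a given vertex of the second class and a given vertex of
the third class. -/
def codegree (H : PartiteHypergraph n₁ n₂ n₃) : Matrix (Fin n₂) (Fin n₃) ℕ :=
  of fun b c => ∑ a, if (a, b, c) ∈ H then 1 else 0

theorem codegree_le (H : PartiteHypergraph n₁ n₂ n₃) (b : Fin n₂) (c : Fin n₃) :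
    H.codegree b c ≤ n₁ := by
  simpa [codegree] using card_filter_le univ fun a => (a, b, c) ∈ H

theorem IsRealization.isTransport_codegree (h : H.IsRealization D) :
    IsTransport univ univ n₁ D.dB D.dC H.codegree where
  le b _ c _ := H.codegree_le b c
  row_sum b _ := (H.degB_eq_sum b).symm.trans (h.2.1 b)
  col_sum c _ := (H.degC_eq_sum c).symm.trans (h.2.2 c)

theorem IsRealization.sum_dB (h : H.IsRealization D) : ∑ b, D.dB b = ∑ a, D.dA a := by
  simp only [← h.1, ← h.2.1, sum_degA, sum_degB]

/-- The hypergraph with the incidence matrix `M`. The pair of the vertices `b` and `c` of the second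
and third class is represented by the row `b * n₃ + c`, the vertex `a` of the first class by the
column `a`. -/
def ofIncidence (n₁ n₂ n₃ : ℕ) (M : Matrix ℕ ℕ ℕ) : PartiteHypergraph n₁ n₂ n₃ :=
  univ.filter fun e => M (e.2.1 * n₃ + e.2.2) e.1 ≠ 0

theorem mem_ofIncidence {M : Matrix ℕ ℕ ℕ} {a : Fin n₁} {b : Fin n₂} {c : Fin n₃} :
    (a, b, c) ∈ ofIncidence n₁ n₂ n₃ M ↔ M (b * n₃ + c) a ≠ 0 := by
  simp [ofIncidence]

theorem isRealization_ofIncidence {m : ℕ → ℕ} {M : Matrix ℕ ℕ ℕ}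
    (hm : IsTransport (range n₂) (range n₃) n₁ (extendZero D.dB) (extendZero D.dC) (rowMajor n₃ m))
    (hM : IsTransport (range (n₂ * n₃)) (range n₁) 1 m (extendZero D.dA) M) :
    (ofIncidence n₁ n₂ n₃ M).IsRealization D := by
  have hrow (b : Fin n₂) (c : Fin n₃) : (b * n₃ + c : ℕ) ∈ range (n₂ * n₃) :=
    mem_range.2 (mul_add_lt_mul_of_lt b.2 c.2)
  have hindicator (a : Fin n₁) (b : Fin n₂) (c : Fin n₃) :
      (if (a, b, c) ∈ ofIncidence n₁ n₂ n₃ M then 1 else 0) = M (b * n₃ + c) a := by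
    have hle := hM.le _ (hrow b c) a (mem_range.2 a.2)
    simp only [mem_ofIncidence]
    split_ifs <;> omega
  have hcodegree (b : Fin n₂) (c : Fin n₃) :
      ∑ a, (if (a, b, c) ∈ ofIncidence n₁ n₂ n₃ M then 1 else 0) = rowMajor n₃ m b c := by
    simp only [hindicator]
    exact (sum_range _).symm.trans (hM.row_sum _ (hrow b c))
  rw [isTransport_range] at hm
  refine ⟨fun a => ?_, fun b => ?_, fun c => ?_⟩
  · rw [degA_eq_sum, ← extendZero_val D.dA, ← hM.col_sum a (mem_range.2 a.2), sum_range_mul]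
    simp only [hindicator, sum_range]
  · simp only [degB_eq_sum, hcodegree, ← hm.row_sum b (mem_univ b), submatrix_apply]
  · simp only [degC_eq_sum, hcodegree, ← hm.col_sum c (mem_univ c), submatrix_apply]

end PartiteHypergraph

namespace DegreeSequence

variable {n₁ n₂ n₃ : ℕ} {D : DegreeSequence n₁ n₂ n₃}

theorem Graphic.exists_isTransport (hD : D.Graphic) :
    ∃ M, IsTransport (range n₂) (range n₃) n₁ (extendZero D.dB) (extendZero D.dC) M :=
  let ⟨_, hH⟩ := hD
  hH.isTransport_codegree.exists_isTransport_range

theorem ThirdAlmostRegular.exists_isTransport (hreg : D.ThirdAlmostRegular)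
    (hsum : ∑ b, D.dB b = ∑ a, D.dA a) {m : ℕ → ℕ}
    (hm : IsTransport (range n₂) (range n₃) n₁ (extendZero D.dB) (extendZero D.dC)
      (rowMajor n₃ m)) :
    ∃ M, IsTransport (range (n₂ * n₃)) (range n₁) 1 m (extendZero D.dA) M := by
  obtain ⟨k, hk⟩ := hreg
  refine _root_.exists_isTransport (fun p hp => ?_) (fun a ha b hb => ?_) ?_
  · rw [mem_range] at hp
    have hpos : 0 < n₃ := Nat.pos_of_lt_mul_left hp
    have hdiv : p / n₃ < n₂ := Nat.div_lt_of_lt_mul (by rwa [mul_comm])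
    simpa [rowMajor, Nat.div_add_mod'] using
      hm.le _ (mem_range.2 hdiv) _ (mem_range.2 (Nat.mod_lt p hpos))
  · lift a to Fin n₁ using mem_range.1 ha
    lift b to Fin n₁ using mem_range.1 hb
    rw [extendZero_val, extendZero_val]
    have := hk a
    have := hk b
    omega
  · rw [sum_extendZero, ← hsum, ← sum_extendZero, sum_range_mul]
    exact sum_congr rfl hm.row_sum

end DegreeSequence

namespace RAM

open Polynomial

/-! ## Running programs with bounded loops -/

namespace State

@[simp] theorem reg_setReg (s : State) (x v y : ℕ) :
    (s.setReg x v).reg y = if y = x then v else s.reg y := Function.update_apply ..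

@[simp] theorem arr_setReg (s : State) (x v : ℕ) : (s.setReg x v).arr = s.arr := rfl

@[simp] theorem reg_setArr (s : State) (a i v : ℕ) : (s.setArr a i v).reg = s.reg := rfl

@[simp] theorem arr_setArr (s : State) (a i v b : ℕ) :
    (s.setArr a i v).arr b = if b = a then Function.update (s.arr a) i v else s.arr b :=
  Function.update_apply ..

/-- All numbers in the memory have at most `w` binary digits. -/
def SizeLE (s : State) (w : ℕ) : Prop :=
  (∀ x, Nat.size (s.reg x) ≤ w) ∧ ∀ a i, Nat.size (s.arr a i) ≤ w

theorem SizeLE.mono {s : State} {w w' : ℕ} (h : s.SizeLE w) (hw : w ≤ w') : s.SizeLE w' :=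
  ⟨fun x => (h.1 x).trans hw, fun a i => (h.2 a i).trans hw⟩

theorem SizeLE.setReg {s : State} {w v : ℕ} (h : s.SizeLE w) (x : ℕ) (hv : Nat.size v ≤ w) :
    (s.setReg x v).SizeLE w := by
  refine ⟨fun y => ?_, h.2⟩
  rw [reg_setReg]
  split_ifs
  exacts [hv, h.1 y]

theorem SizeLE.setArr {s : State} {w v : ℕ} (h : s.SizeLE w) (a i : ℕ) (hv : Nat.size v ≤ w) :
    (s.setArr a i v).SizeLE w := by
  refine ⟨h.1, fun b j => ?_⟩
  rw [arr_setArr]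
  split_ifs
  · rw [Function.update_apply]
    split_ifs
    exacts [hv, h.2 a j]
  · exact h.2 b j

end State

theorem size_add_le {a b w : ℕ} (ha : Nat.size a ≤ w) (hb : Nat.size b ≤ w) :
    Nat.size (a + b) ≤ w + 1 := by
  rw [Nat.size_le] at *
  rw [pow_succ]
  omega

theorem size_sub_le (a b : ℕ) : Nat.size (a - b) ≤ Nat.size a := Nat.size_le_size (Nat.sub_le a b)

/-- Started in `s`, the program `P` halts in a memory satisfying `Q`, at a logarithmic cost that
is controlled by the number `K` of steps: a step lengthens the longest number in the memory by at
most one digit, so it costs at most `2 * (w + K) + 1` if the numbers in `s` have at most `w`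
digits. A constant of `c` digits counts as `c + 1` steps. -/
def Runs (K : ℕ) (P : Prog) (Q : State → Prop) (s : State) : Prop :=
  ∀ w, s.SizeLE w → ∃ t s', Exec P s t s' ∧ t ≤ K * (2 * (w + K) + 1) ∧ s'.SizeLE (w + K) ∧ Q s'

namespace Runs

variable {P P' : Prog} {s : State} {K K' x y z a i : ℕ} {Q R : State → Prop}

theorem mono (h : Runs K P Q s) (hK : K ≤ K') (hQ : ∀ s', Q s' → R s') : Runs K' P R s := by
  intro w hw
  obtain ⟨t, s', hexec, ht, hw', hs'⟩ := h w hw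
  refine ⟨t, s', hexec, ht.trans ?_, hw'.mono (by omega), hQ s' hs'⟩
  gcongr

theorem skip (h : Q s) : Runs 1 .skip Q s := fun w hw =>
  ⟨_, _, .skip s, by omega, hw.mono (by omega), h⟩

theorem const {c : ℕ} (h : Q (s.setReg x c)) : Runs (Nat.size c + 1) (.const x c) Q s :=
  fun w hw => ⟨_, _, .const x c s, by nlinarith, (hw.mono (by omega)).setReg _ (by omega), h⟩

theorem add (h : Q (s.setReg x (s.reg y + s.reg z))) : Runs 1 (.add x y z) Q s := fun w hw =>
  have hy := hw.1 y
  have hz := hw.1 z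
  ⟨_, _, .add x y z s, by omega, (hw.mono (by omega)).setReg _ (size_add_le hy hz), h⟩

theorem sub (h : Q (s.setReg x (s.reg y - s.reg z))) : Runs 1 (.sub x y z) Q s := fun w hw =>
  have hy := hw.1 y
  have hz := hw.1 z
  have hyz := size_sub_le (s.reg y) (s.reg z)
  ⟨_, _, .sub x y z s, by omega, (hw.mono (by omega)).setReg _ (by omega), h⟩

theorem load (h : Q (s.setReg x (s.arr a (s.reg i)))) : Runs 1 (.load x a i) Q s := fun w hw =>
  have hi := hw.1 i
  have ha := hw.2 a (s.reg i)
  ⟨_, _, .load x a i s, by omega, (hw.mono (by omega)).setReg _ (by omega), h⟩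

theorem store (h : Q (s.setArr a (s.reg i) (s.reg x))) : Runs 1 (.store a i x) Q s := fun w hw =>
  have hi := hw.1 i
  have hx := hw.1 x
  ⟨_, _, .store a i x s, by omega, (hw.mono (by omega)).setArr _ _ (by omega), h⟩

theorem seq (h : Runs K P (Runs K' P' Q) s) : Runs (K + K') (.seq P P') Q s := by
  intro w hw
  obtain ⟨t, s', hexec, ht, hw', h'⟩ := h w hw
  obtain ⟨t', s'', hexec', ht', hw'', hQ⟩ := h' _ hw'
  refine ⟨_, _, .seq hexec hexec', ?_, by rwa [← add_assoc], hQ⟩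
  calc t + t' ≤ K * (2 * (w + (K + K')) + 1) + K' * (2 * (w + (K + K')) + 1) := by
        refine add_le_add (ht.trans ?_) (ht'.trans ?_)
        · gcongr
          omega
        · rw [add_assoc w]
    _ = (K + K') * (2 * (w + (K + K')) + 1) := by ring

theorem cond (h : s.reg x ≠ 0 → Runs K P Q s) (h' : s.reg x = 0 → Runs K' P' Q s) :
    Runs (K + K' + 1) (.cond x P P') Q s := by
  intro w hw
  have hx := hw.1 x
  by_cases h0 : s.reg x = 0
  · obtain ⟨t, s', hexec, ht, hw', hQ⟩ := (h' h0).mono (Nat.le_add_left K' K) (fun _ => id) w hw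
    exact ⟨_, _, .condFalse h0 hexec, by nlinarith, hw'.mono (by omega), hQ⟩
  · obtain ⟨t, s', hexec, ht, hw', hQ⟩ := (h h0).mono (Nat.le_add_right K K') (fun _ => id) w hw
    exact ⟨_, _, .condTrue h0 hexec, by nlinarith, hw'.mono (by omega), hQ⟩

theorem loop_done (h0 : s.reg x = 0) (h : Q s) : Runs 1 (.loop x P) Q s := fun w hw =>
  have hx := hw.1 x
  ⟨_, _, .loopDone h0, by omega, hw.mono (by omega), h⟩

theorem loop_step (h0 : s.reg x ≠ 0) (h : Runs K P (Runs K' (.loop x P) Q) s) :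
    Runs (K + K' + 1) (.loop x P) Q s := by
  intro w hw
  have hx := hw.1 x
  obtain ⟨t, s', hexec, ht, hw', h'⟩ := h w hw
  obtain ⟨t', s'', hexec', ht', hw'', hQ⟩ := h' _ hw'
  refine ⟨_, _, .loopStep h0 hexec hexec', ?_, hw''.mono (by omega), hQ⟩
  set W := w + (K + K' + 1)
  calc 1 + Nat.size (s.reg x) + t + t'
      ≤ (2 * W + 1) + K * (2 * W + 1) + K' * (2 * W + 1) := by
        refine add_le_add (add_le_add (by omega) (ht.trans ?_)) (ht'.trans ?_) <;>
          exact Nat.mul_le_mul_left _ (by omega)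
    _ = (K + K' + 1) * (2 * W + 1) := by ring

end Runs

namespace Prog

/-- The weakest precondition of a loop on the register `x` that makes fewer than `k` rounds, where
`body` is the weakest precondition of its body. -/
def loopWp (x : ℕ) (body : (State → Prop) → State → Prop) (Q : State → Prop) : ℕ → State → Prop
  | 0, _ => False
  | k + 1, s => (s.reg x = 0 → Q s) ∧ (s.reg x ≠ 0 → body (loopWp x body Q k) s)

/-- The weakest precondition for `P` to halt in a memory satisfying `Q` while none of its loops,
each time it is entered, makes more than `n` rounds. -/
def wp (n : ℕ) : Prog → (State → Prop) → State → Prop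
  | skip, Q, s => Q s
  | const x c, Q, s => Q (s.setReg x c)
  | add x y z, Q, s => Q (s.setReg x (s.reg y + s.reg z))
  | sub x y z, Q, s => Q (s.setReg x (s.reg y - s.reg z))
  | load x a i, Q, s => Q (s.setReg x (s.arr a (s.reg i)))
  | store a i x, Q, s => Q (s.setArr a (s.reg i) (s.reg x))
  | seq P P', Q, s => P.wp n (P'.wp n Q) s
  | cond x P P', Q, s => (s.reg x ≠ 0 → P.wp n Q s) ∧ (s.reg x = 0 → P'.wp n Q s)
  | loop x P, Q, s => loopWp x (P.wp n) Q (n + 1) s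

/-- A bound on the number of steps of `P`, as a polynomial in the bound on the number of rounds of
its loops. -/
noncomputable def steps : Prog → ℕ[X]
  | const _ c => C (Nat.size c + 1)
  | seq P P' => P.steps + P'.steps
  | cond _ P P' => P.steps + P'.steps + 1
  | loop _ P => (X + 1) * (P.steps + 1)
  | _ => 1

theorem runs_loop_of_loopWp {n x : ℕ} {P : Prog} {K : ℕ}
    (hP : ∀ {R : State → Prop} {s}, P.wp n R s → Runs K P R s) {Q : State → Prop} {k : ℕ}
    {s : State} (h : loopWp x (P.wp n) Q k s) : Runs (k * (K + 1)) (loop x P) Q s := by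
  induction k generalizing s with
  | zero => exact h.elim
  | succ k ih =>
    by_cases h0 : s.reg x = 0
    · exact (Runs.loop_done h0 (h.1 h0)).mono (by nlinarith) fun _ => id
    · have hbody := (hP (h.2 h0)).mono le_rfl fun _ => ih
      exact (Runs.loop_step h0 hbody).mono (by linarith) fun _ => id

theorem runs_of_wp {n : ℕ} {P : Prog} {Q : State → Prop} {s : State} (h : P.wp n Q s) :
    Runs (P.steps.eval n) P Q s := by
  induction P generalizing Q s with
  | skip => exact (Runs.skip h).mono (by simp only [steps, eval_one, le_refl]) fun _ => id
  | const => simpa only [steps, eval_C] using Runs.const h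
  | add => simpa only [steps, eval_one] using Runs.add h
  | sub => simpa only [steps, eval_one] using Runs.sub h
  | load => simpa only [steps, eval_one] using Runs.load h
  | store => simpa only [steps, eval_one] using Runs.store h
  | seq P P' ih ih' =>
    simpa only [steps, eval_add] using Runs.seq ((ih h).mono le_rfl fun _ => ih')
  | cond x P P' ih ih' =>
    simpa only [steps, eval_add, eval_one] using
      Runs.cond (fun h0 => ih (h.1 h0)) fun h0 => ih' (h.2 h0)
  | loop x P ih =>
    simpa only [steps, eval_mul, eval_add, eval_X, eval_one] using runs_loop_of_loopWp ih h

/-! ## Frames and for-loops -/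

/-- Whether the program contains an assignment to the register `r`. -/
def writesReg (r : ℕ) : Prog → Bool
  | const x _ | add x _ _ | sub x _ _ | load x _ _ => x == r
  | seq P P' | cond _ P P' => P.writesReg r || P'.writesReg r
  | loop _ P => P.writesReg r
  | skip | store _ _ _ => false

/-- Whether the program contains an assignment to a cell of the array `a`. -/
def writesArr (a : ℕ) : Prog → Bool
  | store b _ _ => b == a
  | seq P P' | cond _ P P' => P.writesArr a || P'.writesArr a
  | loop _ P => P.writesArr a
  | _ => false

/-- The memories `s` and `s'` agree on all the registers and arrays that `P` does not write. -/
structure Frame (P : Prog) (s s' : State) : Prop where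
  reg {r : ℕ} : P.writesReg r = false → s'.reg r = s.reg r
  arr {a : ℕ} : P.writesArr a = false → s'.arr a = s.arr a

namespace Frame

variable {P P' : Prog} {s s' s'' : State}

theorem refl (P : Prog) (s : State) : P.Frame s s := ⟨fun _ => rfl, fun _ => rfl⟩

theorem trans (h : P.Frame s s') (h' : P.Frame s' s'') : P.Frame s s'' :=
  ⟨fun hr => (h'.reg hr).trans (h.reg hr), fun ha => (h'.arr ha).trans (h.arr ha)⟩

theorem mono (h : P.Frame s s') (hreg : ∀ r, P'.writesReg r = false → P.writesReg r = false)
    (harr : ∀ a, P'.writesArr a = false → P.writesArr a = false) : P'.Frame s s' :=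
  ⟨fun hr => h.reg (hreg _ hr), fun ha => h.arr (harr _ ha)⟩

theorem setReg {x : ℕ} (hx : P.writesReg x = true) (s : State) (v : ℕ) :
    P.Frame s (s.setReg x v) := by
  refine ⟨fun {r} hr => ?_, fun _ => rfl⟩
  rw [State.reg_setReg, if_neg]
  rintro rfl
  simp_all

theorem setArr {a : ℕ} (ha : P.writesArr a = true) (s : State) (i v : ℕ) :
    P.Frame s (s.setArr a i v) := by
  refine ⟨fun _ => rfl, fun {b} hb => ?_⟩
  rw [State.arr_setArr, if_neg]
  rintro rfl
  simp_all

end Frame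

theorem wp_frame {n : ℕ} {P : Prog} {Q Q' : State → Prop} {s : State} (h : P.wp n Q s)
    (hQ : ∀ s', P.Frame s s' → Q s' → Q' s') : P.wp n Q' s := by
  induction P generalizing Q Q' s with
  | skip => exact hQ _ (.refl _ _) h
  | const | add | sub | load => exact hQ _ (.setReg (beq_self_eq_true _) _ _) h
  | store => exact hQ _ (.setArr (beq_self_eq_true _) _ _ _) h
  | seq P P' ih ih' =>
    refine ih h fun s' hf h' => ih' h' fun s'' hf' hs'' => hQ _ (.trans (s' := s') ?_ ?_) hs''
    · exact hf.mono (by simp_all [writesReg]) (by simp_all [writesArr])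
    · exact hf'.mono (by simp_all [writesReg]) (by simp_all [writesArr])
  | cond x P P' ih ih' =>
    refine ⟨fun h0 => ih (h.1 h0) fun s' hf => hQ s' ?_,
      fun h0 => ih' (h.2 h0) fun s' hf => hQ s' ?_⟩ <;>
    exact hf.mono (by simp_all [writesReg]) (by simp_all [writesArr])
  | loop x P ih =>
    simp only [wp] at h ⊢
    generalize n + 1 = k at h ⊢
    induction k generalizing s with
    | zero => exact h
    | succ k ihk =>
      refine ⟨fun h0 => hQ s (.refl _ s) (h.1 h0), fun h0 => ih (h.2 h0) fun s' hf h' => ?_⟩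
      exact ihk (fun s'' hf' => hQ s'' (.trans (hf.mono (fun _ => id) fun _ => id) hf')) h'

theorem wp_seq_frame {n : ℕ} {P P' : Prog} {Q R : State → Prop} {s : State} (h : P.wp n R s)
    (hQ : ∀ s', P.Frame s s' → R s' → P'.wp n Q s') : (seq P P').wp n Q s :=
  wp_frame (P := P) h hQ

/-- Sequential composition of a list of programs. -/
def block : List Prog → Prog
  | [] => skip
  | [P] => P
  | P :: Ps => seq P (block Ps)

/-- `for i < b do P`, where `P` may change the register `b` without an effect on the number of
rounds. The register `i + 1` holds the number of rounds left, and `i + 2` is scratch. -/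
def forRange (i b : ℕ) (P : Prog) : Prog := block
  [.const i 0, .add (i + 1) b i,
    .loop (i + 1) (block [P, .const (i + 2) 1, .add i i (i + 2), .sub (i + 1) (i + 1) (i + 2)])]

theorem Frame.forRange {i b : ℕ} {P : Prog} {s s' : State} (h : P.Frame s s') (u v w : ℕ) :
    (forRange i b P).Frame s (((s'.setReg (i + 2) w).setReg i u).setReg (i + 1) v) :=
  .trans (.trans (.trans
    (h.mono (by simp +contextual [Prog.forRange, block, writesReg])
      (by simp +contextual [Prog.forRange, block, writesArr]))
    (.setReg (by simp [Prog.forRange, block, writesReg]) _ w))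
    (.setReg (by simp [Prog.forRange, block, writesReg]) _ u))
    (.setReg (by simp [Prog.forRange, block, writesReg]) _ v)

theorem wp_forRange {n i b N : ℕ} {P : Prog} {s : State} (I : ℕ → State → Prop)
    (hN : s.reg b = N) (hn : N ≤ n) (hinit : I 0 s)
    (hstep : ∀ j < N, ∀ s', (forRange i b P).Frame s s' → s'.reg i = j → I j s' →
      P.wp n (I (j + 1)) s')
    (hI : ∀ j s' u v w, I j s' → I j (((s'.setReg (i + 2) w).setReg i u).setReg (i + 1) v) :=
      by intros; simpa)
    (hb : b ≠ i := by decide) (hi : P.writesReg i = false := by rfl)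
    (hi' : P.writesReg (i + 1) = false := by rfl) :
    (forRange i b P).wp n (I N) s := by
  have hloop : ∀ k j s', (forRange i b P).Frame s s' → s'.reg i = j → s'.reg (i + 1) + j = N →
      s'.reg (i + 1) < k → I j s' →
      loopWp (i + 1) ((block [P, .const (i + 2) 1, .add i i (i + 2),
        .sub (i + 1) (i + 1) (i + 2)]).wp n) (I N) k s' := by
    intro k
    induction k with
    | zero => exact fun _ _ _ _ _ hk => absurd hk (Nat.not_lt_zero _)
    | succ k ih =>
      intro j s' hf hj hleft hk hs'
      refine ⟨fun h0 => by rwa [← hleft, h0, zero_add], fun h0 => ?_⟩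
      have hbody := hstep j (by omega) s' hf hj hs'
      refine wp_seq_frame hbody fun s'' hf' hs'' => ?_
      have hj' : s''.reg i = j := (hf'.reg hi).trans hj
      have hleft' : s''.reg (i + 1) = s'.reg (i + 1) := hf'.reg hi'
      have hsum : s'.reg (i + 1) - 1 + (j + 1) = N := by omega
      have hlt : s'.reg (i + 1) - 1 < k := by omega
      refine ih (j + 1) _ (hf.trans (hf'.forRange ..)) ?_ ?_ ?_ (hI _ _ _ _ _ hs'')
      exacts [by simp [hj'], by simpa [hleft'], by simpa [hleft']]
  have hscratch : s.setReg (i + 2) (s.reg (i + 2)) = s := by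
    simp only [State.setReg, Function.update_eq_self]
  have hstart := hI 0 s 0 N (s.reg (i + 2)) hinit
  have hframe := Frame.forRange (i := i) (b := b) (.refl P s) 0 N (s.reg (i + 2))
  rw [hscratch] at hstart hframe
  refine hloop (n + 1) 0 _ ?_ ?_ ?_ ?_ ?_ <;> simp [hb, hN, hframe, hstart, Nat.lt_succ_of_le hn]

end Prog
end RAM

namespace RAM

/-! ## The program -/

namespace Reg

-- The numbers of these five registers are prescribed by the format of the input and the output.
@[simp] abbrev lenA : ℕ := 0
@[simp] abbrev lenB : ℕ := 1
@[simp] abbrev lenC : ℕ := 2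
@[simp] abbrev answer : ℕ := 3
@[simp] abbrev count : ℕ := 4

@[simp] abbrev numRows : ℕ := 5
@[simp] abbrev numCols : ℕ := 6
@[simp] abbrev cap : ℕ := 7
/-- What the row and column sums of the matrices constructed so far lack in total. -/
@[simp] abbrev lack : ℕ := 8

/-- The address of the first entry of the current row. -/
@[simp] abbrev base : ℕ := 9

@[simp] abbrev best : ℕ := 10
@[simp] abbrev bestVal : ℕ := 11
@[simp] abbrev addr : ℕ := 12
@[simp] abbrev val : ℕ := 13
@[simp] abbrev test : ℕ := 14
@[simp] abbrev one : ℕ := 15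
@[simp] abbrev pos : ℕ := 16

-- A counter of a for-loop takes up three consecutive registers.
@[simp] abbrev row : ℕ := 20
@[simp] abbrev tryCol : ℕ := 23
@[simp] abbrev tryUnit : ℕ := 26
@[simp] abbrev col : ℕ := 29
@[simp] abbrev vertexB : ℕ := 32
@[simp] abbrev vertexC : ℕ := 35
@[simp] abbrev vertexA : ℕ := 38

end Reg

open Prog

/-- `x := y` for distinct registers `x` and `y`. -/
def copy (x y : ℕ) : Prog := block [.const x 0, .add x x y]

/-- Find the column with room in the current row of the array `o` that maximises the array `c`, and
put it into `best` and its value in `c` into `bestVal`. -/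
def scan (c o : ℕ) : Prog := block
  [.const Reg.bestVal 0,
    forRange Reg.col Reg.numCols (block
      [.add Reg.addr Reg.base Reg.col, .load Reg.test o Reg.addr,
        .sub Reg.test Reg.cap Reg.test,
        .cond Reg.test (block
          [.load Reg.val c Reg.col, .sub Reg.test Reg.val Reg.bestVal,
            .cond Reg.test (block [copy Reg.best Reg.col, copy Reg.bestVal Reg.val]) .skip])
          .skip])]

/-- `best` maximises `a` among the indices less than `k` with room, and `bestVal` is its value. If
`a` vanishes at all these indices then `bestVal = 0`, and `best` is arbitrary. -/
structure IsBest (k : ℕ) (room : ℕ → Prop) (a : ℕ → ℕ) (best bestVal : ℕ) : Prop where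
  eq_of_ne_zero : bestVal ≠ 0 → best < k ∧ room best ∧ a best = bestVal
  le : ∀ y < k, room y → a y ≤ bestVal

namespace IsBest

variable {k best bestVal : ℕ} {room : ℕ → Prop} {a : ℕ → ℕ}

theorem zero (room : ℕ → Prop) (a : ℕ → ℕ) (best : ℕ) : IsBest 0 room a best 0 :=
  ⟨fun h => absurd rfl h, fun _ hy => absurd hy (Nat.not_lt_zero _)⟩

theorem keep (h : IsBest k room a best bestVal) (hk : room k → a k ≤ bestVal) :
    IsBest (k + 1) room a best bestVal := by
  refine ⟨fun h0 => (h.eq_of_ne_zero h0).imp_left Nat.lt_succ_of_lt, fun y hy hroom => ?_⟩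
  rcases Nat.lt_succ_iff_lt_or_eq.1 hy with hlt | rfl
  exacts [h.le y hlt hroom, hk hroom]

theorem improve (h : IsBest k room a best bestVal) (hroom : room k) (hk : bestVal ≤ a k) :
    IsBest (k + 1) room a k (a k) := by
  refine ⟨fun _ => ⟨Nat.lt_succ_self k, hroom, rfl⟩, fun y hy hy' => ?_⟩
  rcases Nat.lt_succ_iff_lt_or_eq.1 hy with hlt | rfl
  exacts [(h.le y hlt hy').trans hk, le_rfl]

end IsBest

theorem wp_scan {n c o : ℕ} {s : State} (hn : s.reg Reg.numCols ≤ n) :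
    (scan c o).wp n (fun s' => IsBest (s.reg Reg.numCols)
      (fun y => s.arr o (s.reg Reg.base + y) < s.reg Reg.cap) (s.arr c)
      (s'.reg Reg.best) (s'.reg Reg.bestVal)) s := by
  refine wp_forRange (fun k s' => IsBest k
      (fun y => s.arr o (s.reg Reg.base + y) < s.reg Reg.cap) (s.arr c)
      (s'.reg Reg.best) (s'.reg Reg.bestVal)) rfl hn (.zero ..) fun k _ s' hf hk hbest => ?_
  have hcap : s'.reg Reg.cap = s.reg Reg.cap := hf.reg rfl
  have hbase : s'.reg Reg.base = s.reg Reg.base := hf.reg rfl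
  have ho : s'.arr o = s.arr o := hf.arr rfl
  have hc : s'.arr c = s.arr c := hf.arr rfl
  simpa [block, wp, copy, hcap, hbase, ho, hc, hk, Nat.sub_eq_zero_iff_le] using And.intro
    (fun hroom : s.arr o (s.reg Reg.base + k) < s.reg Reg.cap => And.intro
      (fun hlt : s'.reg Reg.bestVal < s.arr c k => hbest.improve hroom hlt.le)
      fun hle : s.arr c k ≤ s'.reg Reg.bestVal => hbest.keep fun _ => hle)
    fun hfull : s.reg Reg.cap ≤ s.arr o (s.reg Reg.base + k) =>
      hbest.keep fun hroom => absurd hroom hfull.not_gt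

/-- Reduce `r` in the current row and `c` in a column by one, and put a unit into the corresponding
cell of the array `o`, where the column has room and maximises `c`. -/
def placeUnit (r c o : ℕ) : Prog := block
  [scan c o, .load Reg.test r Reg.row,
    .cond Reg.test
      (.cond Reg.bestVal (block
        [.const Reg.one 1,
          .sub Reg.test Reg.test Reg.one, .store r Reg.row Reg.test,
          .sub Reg.bestVal Reg.bestVal Reg.one, .store c Reg.best Reg.bestVal,
          .add Reg.addr Reg.base Reg.best, .load Reg.val o Reg.addr,
          .add Reg.val Reg.val Reg.one, .store o Reg.addr Reg.val]) .skip) .skip]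

/-- The memory while the greedy algorithm runs with the arrays `r`, `c` and `o`. -/
structure GreedyState (R C q : ℕ) (row col : ℕ → ℕ) (r c o i u : ℕ) (s : State) : Prop where
  numRows : s.reg Reg.numRows = R
  numCols : s.reg Reg.numCols = C
  cap : s.reg Reg.cap = q
  base : s.reg Reg.base = i * C
  inv : GreedyInv R C q row col i u (s.arr o) (s.arr r) (s.arr c)

namespace GreedyState

variable {n R C q r c o i u : ℕ} {row col : ℕ → ℕ} {s : State}

theorem setReg (h : GreedyState R C q row col r c o i u s) {x : ℕ} (v : ℕ)
    (hx : x ∉ [Reg.numRows, Reg.numCols, Reg.cap, Reg.base] := by decide) :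
    GreedyState R C q row col r c o i u (s.setReg x v) := by
  simp only [List.mem_cons, not_or] at hx
  exact ⟨by simp [h.numRows, Ne.symm, hx], by simp [h.numCols, Ne.symm, hx],
    by simp [h.cap, Ne.symm, hx], by simp [h.base, Ne.symm, hx], h.inv⟩

theorem forRange {j v w x : ℕ} (h : GreedyState R C q row col r c o i u s)
    (hj : Reg.row ≤ j := by decide) :
    GreedyState R C q row col r c o i u (((s.setReg (j + 2) x).setReg j v).setReg (j + 1) w) := by
  simp only [Reg.row] at hj
  refine ((h.setReg _ ?_).setReg _ ?_).setReg _ ?_ <;> simp <;> omega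

theorem idle (h : GreedyState R C q row col r c o i u s) (hu : u < C * q)
    (hstuck : s.arr r i = 0 ∨ ∀ y < C, s.arr o (i * C + y) < q → s.arr c y = 0) :
    GreedyState R C q row col r c o i (u + 1) s :=
  { h with inv := h.inv.idle hu hstuck }

end GreedyState

section Greedy

variable {n R C q r c o i u : ℕ} {row col : ℕ → ℕ} {s : State}

theorem wp_placeUnit (hC : C ≤ n) (hrc : r ≠ c) (hro : r ≠ o) (hco : c ≠ o)
    (h : GreedyState R C q row col r c o i u s) (hrow : s.reg Reg.row = i) (hi : i < R)
    (hu : u < C * q) :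
    (placeUnit r c o).wp n (GreedyState R C q row col r c o i (u + 1)) s := by
  refine wp_seq_frame (wp_scan (h.numCols.trans_le hC)) fun s' hf hbest => ?_
  have hrow' : s'.reg Reg.row = i := (hf.reg rfl).trans hrow
  have hr : s'.arr r = s.arr r := hf.arr rfl
  have hc : s'.arr c = s.arr c := hf.arr rfl
  have ho : s'.arr o = s.arr o := hf.arr rfl
  have hs' : GreedyState R C q row col r c o i u s' :=
    ⟨(hf.reg rfl).trans h.numRows, (hf.reg rfl).trans h.numCols, (hf.reg rfl).trans h.cap,
      (hf.reg rfl).trans h.base, by simpa only [hr, hc, ho] using h.inv⟩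
  rw [h.numCols, h.base, h.cap, ← hc, ← ho] at hbest
  refine ⟨fun hr0 => ⟨fun hbest0 => ?_, fun hbest0 => (hs'.setReg _).idle hu (.inr ?_)⟩,
    fun hr0 => (hs'.setReg _).idle hu (.inl ?_)⟩
  · obtain ⟨hlt, hroom, hval⟩ := hbest.eq_of_ne_zero hbest0
    have hplace := hs'.inv.place hi hlt (by simpa [hrow'] using hr0) (hval ▸ hbest0) hroom
      fun y hy hroom' => hval ▸ hbest.le y hy hroom'
    refine ⟨by simpa using hs'.numRows, by simpa using hs'.numCols, by simpa using hs'.cap,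
      by simpa using hs'.base, ?_⟩
    simpa [hs'.base, hrow', hval, hrc, hrc.symm, hro, hro.symm, hco, hco.symm] using hplace
  · exact fun y hy hroom => Nat.eq_zero_of_le_zero ((hbest.le y hy hroom).trans hbest0.le)
  · simpa [hrow'] using hr0

/-- Fill the array `o` greedily with a matrix whose row sums are at most the entries of `r` and
whose column sums are at most those of `c`. These arrays end up with what the sums lack. -/
def greedy (r c o : ℕ) : Prog := block
  [.const Reg.base 0,
    forRange Reg.row Reg.numRows (block
      [forRange Reg.tryCol Reg.numCols (forRange Reg.tryUnit Reg.cap (placeUnit r c o)),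
        .add Reg.base Reg.base Reg.numCols])]

theorem wp_fillRow (hC : C ≤ n) (hq : q ≤ n) (hrc : r ≠ c) (hro : r ≠ o) (hco : c ≠ o)
    (h : GreedyState R C q row col r c o i 0 s) (hrow : s.reg Reg.row = i) (hi : i < R) :
    (forRange Reg.tryCol Reg.numCols (forRange Reg.tryUnit Reg.cap (placeUnit r c o))).wp n
      (GreedyState R C q row col r c o i (C * q)) s := by
  refine wp_forRange (fun u => GreedyState R C q row col r c o i (u * q)) h.numCols hC
    (by rwa [zero_mul]) (fun u hu s' hf _ hs' => ?_) fun _ _ _ _ _ => .forRange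
  have hrow' : s'.reg Reg.row = i := (hf.reg rfl).trans hrow
  rw [add_one_mul]
  refine wp_forRange (fun v => GreedyState R C q row col r c o i (u * q + v)) hs'.cap hq hs'
    (fun v hv s'' hf' _ hs'' => ?_) fun _ _ _ _ _ => .forRange
  exact wp_placeUnit hC hrc hro hco hs'' ((hf'.reg rfl).trans hrow') hi
    (mul_add_lt_mul_of_lt hu hv)

theorem wp_greedy (hR : R ≤ n) (hC : C ≤ n) (hq : q ≤ n)
    (hrc : r ≠ c) (hro : r ≠ o) (hco : c ≠ o)
    (hs : s.reg Reg.numRows = R ∧ s.reg Reg.numCols = C ∧ s.reg Reg.cap = q) (ho : s.arr o = 0) :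
    (greedy r c o).wp n (GreedyState R C q (s.arr r) (s.arr c) r c o R 0) s := by
  have hinv := GreedyInv.zero R C q (s.arr r) (s.arr c)
  rw [← ho] at hinv
  obtain ⟨hnumRows, hnumCols, hcap⟩ := hs
  refine wp_forRange (fun i => GreedyState R C q (s.arr r) (s.arr c) r c o i 0) (by simpa) hR
    ⟨by simpa, by simpa, by simpa, by simp, hinv⟩ (fun i hi s' _ hrow hs' => ?_)
    fun _ _ _ _ _ => .forRange
  refine wp_seq_frame (wp_fillRow hC hq hrc hro hco hs' hrow hi) fun s'' _ hs'' => ?_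
  exact ⟨by simpa using hs''.numRows, by simpa using hs''.numCols, by simpa using hs''.cap,
    by simp [hs''.base, hs''.numCols, add_one_mul], hs''.inv.next hi⟩

/-- Add the entries of the array `a` with index less than `b` to `lack`. -/
def sumInto (a b : ℕ) : Prog :=
  forRange Reg.col b (block [.load Reg.val a Reg.col, .add Reg.lack Reg.lack Reg.val])

theorem wp_sumInto {a b N : ℕ} (hN : s.reg b = N) (hn : N ≤ n) (hb : b ≠ Reg.col) :
    (sumInto a b).wp n (fun s' => s'.reg Reg.lack = s.reg Reg.lack + ∑ j ∈ range N, s.arr a j) s :=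
  wp_forRange (fun k s' => s'.reg Reg.lack = s.reg Reg.lack + ∑ j ∈ range k, s.arr a j) hN hn
    (by simp) (hb := hb) fun k _ s' hf hk hs' => by
      have ha : s'.arr a = s.arr a := hf.arr rfl
      simp [block, wp, ha, hk, hs', sum_range_succ, add_assoc]

/-- Copy the registers `x`, `y` and `z` to `numRows`, `numCols` and `cap`. -/
def setSize (x y z : ℕ) : Prog :=
  block [copy Reg.numRows x, copy Reg.numCols y, copy Reg.cap z]

theorem wp_setSize (n : ℕ) {x y z : ℕ} (hx : x ≠ Reg.numRows) (hy : y ∉ [Reg.numRows, Reg.numCols])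
    (hz : z ∉ [Reg.numRows, Reg.numCols, Reg.cap]) :
    (setSize x y z).wp n (fun s' => s'.reg Reg.numRows = s.reg x ∧ s'.reg Reg.numCols = s.reg y ∧
      s'.reg Reg.cap = s.reg z) s := by
  simp only [List.mem_cons, not_or] at hy hz
  simp [setSize, block, copy, wp, hx, hy, hz]

/-- Run the greedy algorithm for a matrix with `x` rows and `y` columns with entries at most `z`,
and add what its row and column sums lack to `lack`. -/
def fill (x y z r c o : ℕ) : Prog := block
  [setSize x y z, greedy r c o, sumInto r Reg.numRows, sumInto c Reg.numCols]

/-- The effect of `fill x y z r c o` if the registers `x`, `y` and `z` contain `R`, `C` and `q`. -/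
structure Filled (R C q r c o : ℕ) (s s' : State) : Prop where
  base : s'.reg Reg.base = R * C
  lack_le : s.reg Reg.lack ≤ s'.reg Reg.lack
  isTransport : s'.reg Reg.lack = s.reg Reg.lack →
    IsTransport (range R) (range C) q (s.arr r) (s.arr c) (rowMajor C (s'.arr o))
  lack_eq : (∃ M, IsTransport (range R) (range C) q (s.arr r) (s.arr c) M) →
    s'.reg Reg.lack = s.reg Reg.lack

theorem wp_fill {x y z : ℕ} (hx : x ≠ Reg.numRows) (hy : y ∉ [Reg.numRows, Reg.numCols])
    (hz : z ∉ [Reg.numRows, Reg.numCols, Reg.cap])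
    (hrc : r ≠ c) (hro : r ≠ o) (hco : c ≠ o)
    (hR : s.reg x = R) (hC : s.reg y = C) (hq : s.reg z = q)
    (hRn : R ≤ n) (hCn : C ≤ n) (hqn : q ≤ n) (ho : s.arr o = 0) :
    (fill x y z r c o).wp n (Filled R C q r c o s) s := by
  refine wp_seq_frame (wp_setSize n hx hy hz) fun s₀ hf₀ hsize => ?_
  rw [hR, hC, hq] at hsize
  have ho₀ : s₀.arr o = 0 := (hf₀.arr rfl).trans ho
  refine wp_seq_frame (wp_greedy hRn hCn hqn hrc hro hco hsize ho₀) fun s₁ hf₁ h => ?_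
  rw [hf₀.arr rfl, hf₀.arr rfl] at h
  refine wp_seq_frame (wp_sumInto h.numRows hRn (by decide)) fun s₂ hf₂ hrow => ?_
  have hnumCols : s₂.reg Reg.numCols = C := (hf₂.reg rfl).trans h.numCols
  refine wp_frame (wp_sumInto hnumCols hCn (by decide)) fun s₃ hf₃ hcol => ?_
  have hlack : s₁.reg Reg.lack = s.reg Reg.lack := (hf₁.reg rfl).trans (hf₀.reg rfl)
  have ho₃ : s₃.arr o = s₁.arr o := (hf₃.arr rfl).trans (hf₂.arr rfl)
  rw [hrow, hlack, hf₂.arr rfl, add_assoc] at hcol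
  refine ⟨?_, hcol ▸ Nat.le_add_right _ _, fun h0 => ?_, fun hsol => ?_⟩
  · rw [hf₃.reg rfl, hf₂.reg rfl, h.base]
  · rw [ho₃]
    exact h.inv.isTransport_of_sum_eq_zero (by omega)
  · rw [hcol, h.inv.sum_eq_zero_of_exists hsol, add_zero]

end Greedy
end RAM

namespace RAM

open Prog

/-! ## Listing the hyperedges -/

/-- Entry `p` of an array that is indexed by the triples in `Fin n₁ × Fin n₂ × Fin n₃`, in the order
of the second component, then the third, then the first, belongs to the triple `triple n₁ n₃ p`. -/
def triple (n₁ n₃ p : ℕ) : ℕ × ℕ × ℕ := (p % n₁, p / n₁ / n₃, p / n₁ % n₃)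

theorem triple_mul_add {n₁ n₃ a c : ℕ} (ha : a < n₁) (b : ℕ) (hc : c < n₃) :
    triple n₁ n₃ ((b * n₃ + c) * n₁ + a) = (a, b, c) := by
  rw [triple, Nat.mul_add_mod_of_lt ha, mul_add_div_of_lt _ ha, mul_add_div_of_lt _ hc,
    Nat.mul_add_mod_of_lt hc]

theorem eq_mul_add_of_triple_eq {n₁ n₃ p a b c : ℕ} (h : triple n₁ n₃ p = (a, b, c)) :
    p = (b * n₃ + c) * n₁ + a := by
  obtain ⟨rfl, rfl, rfl⟩ := by simpa only [triple, Prod.mk.injEq] using h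
  rw [Nat.div_add_mod', Nat.div_add_mod']

theorem triple_injective (n₁ n₃ : ℕ) : Function.Injective (triple n₁ n₃) := fun _ _ h =>
  (eq_mul_add_of_triple_eq h).trans (eq_mul_add_of_triple_eq rfl).symm

/-- The triples that belong to the first `m` entries of the array `f`, apart from the zeros. -/
def support (n₁ n₃ : ℕ) (f : ℕ → ℕ) (m : ℕ) : List (ℕ × ℕ × ℕ) :=
  ((List.range m).filter fun p => f p ≠ 0).map (triple n₁ n₃)

theorem support_succ (n₁ n₃ : ℕ) (f : ℕ → ℕ) (m : ℕ) :
    support n₁ n₃ f (m + 1) =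
      support n₁ n₃ f m ++ if f m = 0 then [] else [triple n₁ n₃ m] := by
  rw [support, List.range_succ, List.filter_append, List.map_append]
  split_ifs with h <;> simp [support, h]

theorem nodup_support (n₁ n₃ : ℕ) (f : ℕ → ℕ) (m : ℕ) : (support n₁ n₃ f m).Nodup :=
  (List.nodup_range.filter _).map (triple_injective n₁ n₃)

theorem mem_support_mul {n₁ n₂ n₃ a b c : ℕ} {f : ℕ → ℕ} :
    (a, b, c) ∈ support n₁ n₃ f (n₂ * n₃ * n₁) ↔
      (a < n₁ ∧ b < n₂ ∧ c < n₃) ∧ rowMajor n₁ f (b * n₃ + c) a ≠ 0 := by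
  simp only [support, List.mem_map, List.mem_filter, List.mem_range, decide_eq_true_eq]
  constructor
  · rintro ⟨p, ⟨hp, hfp⟩, htriple⟩
    rw [eq_mul_add_of_triple_eq htriple] at hfp
    obtain ⟨rfl, rfl, rfl⟩ := by simpa only [triple, Prod.mk.injEq] using htriple
    have hrow : p / n₁ < n₂ * n₃ := Nat.div_lt_of_lt_mul (by rwa [mul_comm])
    exact ⟨⟨Nat.mod_lt _ (Nat.pos_of_lt_mul_left hp),
      Nat.div_lt_of_lt_mul (by rwa [mul_comm]), Nat.mod_lt _ (Nat.pos_of_lt_mul_left hrow)⟩, hfp⟩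
  · rintro ⟨⟨ha, hb, hc⟩, hf⟩
    have hrow := mul_add_lt_mul_of_lt hb hc
    exact ⟨_, ⟨mul_add_lt_mul_of_lt hrow ha, hf⟩, triple_mul_add ha b hc⟩

theorem State.edgeList_setReg {x : ℕ} (hx : x ≠ Reg.count) (s : State) (v : ℕ) :
    (s.setReg x v).edgeList = s.edgeList := by
  simp [edgeList, Ne.symm hx]

/-- Append the triple in the registers `x`, `y` and `z` to the output. -/
def append (x y z : ℕ) : Prog := block
  [.store 3 Reg.count x, .store 4 Reg.count y, .store 5 Reg.count z,
    .const Reg.one 1, .add Reg.count Reg.count Reg.one]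

theorem wp_append (n : ℕ) (s : State) {x y z : ℕ} :
    (append x y z).wp n
      (fun s' => s'.edgeList = s.edgeList ++ [(s.reg x, s.reg y, s.reg z)]) s := by
  simp +contextual [append, block, wp, State.edgeList, List.range_succ, ne_of_lt]

/-- If the entry `pos` of the array `7` is not zero, append the triple in the registers `x`, `y` and
`z` to the output. -/
def appendIfNeZero (x y z : ℕ) : Prog := block
  [.load Reg.test 7 Reg.pos, .cond Reg.test (append x y z) .skip]

/-- Append the triples of the nonzero entries of the array `7` to the output. -/
def emit : Prog := block
  [.const Reg.pos 0,
    forRange Reg.vertexB Reg.lenB (forRange Reg.vertexC Reg.lenC (forRange Reg.vertexA Reg.lenA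
      (block [appendIfNeZero Reg.vertexA Reg.vertexB Reg.vertexC,
        .const Reg.one 1, .add Reg.pos Reg.pos Reg.one])))]

/-- The first `p` entries of `f` have been listed. -/
structure Emitted (n₁ n₃ : ℕ) (f : ℕ → ℕ) (p : ℕ) (s : State) : Prop where
  pos : s.reg Reg.pos = p
  edgeList : s.edgeList = support n₁ n₃ f p

section Emit

variable {n₁ n₂ n₃ p : ℕ} {f : ℕ → ℕ} {s : State}

theorem Emitted.forRange {j v w x : ℕ} (h : Emitted n₁ n₃ f p s)
    (hj : Reg.pos < j := by decide) :
    Emitted n₁ n₃ f p (((s.setReg (j + 2) x).setReg j v).setReg (j + 1) w) := by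
  simp only [Reg.pos] at hj
  constructor
  · simpa [show 16 ≠ j by omega, show 16 ≠ j + 1 by omega, show 16 ≠ j + 2 by omega] using h.pos
  · rw [State.edgeList_setReg, State.edgeList_setReg, State.edgeList_setReg, h.edgeList] <;>
      rw [Reg.count] <;> omega

theorem wp_appendIfNeZero (n : ℕ) {x y z : ℕ} (hf : s.arr 7 = f) (h : Emitted n₁ n₃ f p s)
    (hp : triple n₁ n₃ p = (s.reg x, s.reg y, s.reg z))
    (hx : x ≠ Reg.test) (hy : y ≠ Reg.test) (hz : z ≠ Reg.test) :
    (appendIfNeZero x y z).wp n (fun s' => s'.edgeList = support n₁ n₃ f (p + 1)) s := by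
  have hload : s.arr 7 (s.reg Reg.pos) = f p := by rw [hf, h.pos]
  have hlist : (s.setReg Reg.test (f p)).edgeList = support n₁ n₃ f p := by
    rw [State.edgeList_setReg (by decide), h.edgeList]
  refine ⟨fun h0 => wp_frame (P := append x y z) (wp_append n _) fun s' _ hs' => ?_, fun h0 => ?_⟩
  · simpa [hs', hload, hlist, support_succ, hp, hx, hy, hz] using h0
  · simpa [wp, hload, hlist, support_succ] using h0

theorem wp_emit {n : ℕ} (hlenA : s.reg Reg.lenA = n₁) (hlenB : s.reg Reg.lenB = n₂)
    (hlenC : s.reg Reg.lenC = n₃) (hn₁ : n₁ ≤ n) (hn₂ : n₂ ≤ n) (hn₃ : n₃ ≤ n)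
    (hf : s.arr 7 = f) (hcount : s.reg Reg.count = 0) :
    emit.wp n (fun s' => s'.edgeList = support n₁ n₃ f (n₂ * n₃ * n₁)) s := by
  suffices emit.wp n (Emitted n₁ n₃ f (n₂ * n₃ * n₁)) s from
    wp_frame this fun _ _ h => h.edgeList
  refine wp_forRange (fun b => Emitted n₁ n₃ f (b * n₃ * n₁)) hlenB hn₂
    ⟨by simp, by simp [State.edgeList, support, hcount]⟩
    (fun b _ s₁ hs₁ hb h₁ => ?_) fun _ _ _ _ _ => .forRange
  rw [add_one_mul]
  refine wp_forRange (fun c => Emitted n₁ n₃ f ((b * n₃ + c) * n₁)) ((hs₁.reg rfl).trans hlenC) hn₃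
    (by simpa) (fun c hc s₂ hs₂ hc' h₂ => ?_) fun _ _ _ _ _ => .forRange
  rw [← add_assoc, add_one_mul]
  refine wp_forRange (fun a => Emitted n₁ n₃ f ((b * n₃ + c) * n₁ + a))
    ((hs₂.reg rfl).trans ((hs₁.reg rfl).trans hlenA)) hn₁
    (by simpa) (fun a ha s₃ hs₃ ha' h₃ => ?_) fun _ _ _ _ _ => .forRange
  have harr : s₃.arr 7 = f := by rw [hs₃.arr rfl, hs₂.arr rfl, hs₁.arr rfl]; exact hf
  have htriple : triple n₁ n₃ ((b * n₃ + c) * n₁ + a) =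
      (s₃.reg Reg.vertexA, s₃.reg Reg.vertexB, s₃.reg Reg.vertexC) := by
    rw [triple_mul_add ha b hc, ha', hs₃.reg (r := Reg.vertexC) rfl, hc', hs₃.reg rfl,
      hs₂.reg rfl, hb]
  refine wp_seq_frame (wp_appendIfNeZero n harr h₃ htriple (by decide) (by decide) (by decide))
    fun s' hs' hlist => ?_
  have hpos : s'.reg Reg.pos = (b * n₃ + c) * n₁ + a := (hs'.reg rfl).trans h₃.pos
  refine ⟨by simpa [← add_assoc] using hpos, ?_⟩
  rwa [State.edgeList_setReg (by decide), State.edgeList_setReg (by decide)]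

end Emit

end RAM

namespace RAM

open Prog

/-! ## The algorithm -/

/-- Distribute the degrees of the second and third classes over the pairs of their vertices, and
then these codegrees over the first class. The codegrees go into the array `6`, where the second
`fill` uses them up, and the incidence matrix goes into the array `7`. -/
def distribute : Prog := block
  [fill Reg.lenB Reg.lenC Reg.lenA 1 2 6, .const Reg.one 1, fill Reg.base Reg.lenA Reg.one 6 0 7]

/-- Decide whether the degree sequence in the arrays `0`, `1` and `2` is graphic, and list the
hyperedges of a realization. -/
def realize : Prog := block
  [distribute, emit, .const Reg.answer 1, .sub Reg.answer Reg.answer Reg.lack]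

/-- The final memory of `distribute`, for the degrees `dA`, `dB` and `dC`. -/
structure Distributed (n₁ n₂ n₃ : ℕ) (dA dB dC : ℕ → ℕ) (s : State) : Prop where
  exists_codegree : s.reg Reg.lack = 0 →
    ∃ m, IsTransport (range n₂) (range n₃) n₁ dB dC (rowMajor n₃ m) ∧
      IsTransport (range (n₂ * n₃)) (range n₁) 1 m dA (rowMajor n₁ (s.arr 7))
  lack_eq_zero : (∃ M, IsTransport (range n₂) (range n₃) n₁ dB dC M) →
    (∀ m, IsTransport (range n₂) (range n₃) n₁ dB dC (rowMajor n₃ m) →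
      ∃ M, IsTransport (range (n₂ * n₃)) (range n₁) 1 m dA M) → s.reg Reg.lack = 0

section Realize

variable {n n₁ n₂ n₃ : ℕ} {D : DegreeSequence n₁ n₂ n₃} {s : State}

theorem wp_distribute (hlenA : s.reg Reg.lenA = n₁) (hlenB : s.reg Reg.lenB = n₂)
    (hlenC : s.reg Reg.lenC = n₃) (hlack : s.reg Reg.lack = 0) (h6 : s.arr 6 = 0) (h7 : s.arr 7 = 0)
    (hn₁ : n₁ ≤ n) (hn₂ : n₂ ≤ n) (hn₃ : n₃ ≤ n) (hn₂₃ : n₂ * n₃ ≤ n) (hn : 1 ≤ n) :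
    distribute.wp n (Distributed n₁ n₂ n₃ (s.arr 0) (s.arr 1) (s.arr 2)) s := by
  refine wp_seq_frame (wp_fill (by decide) (by decide) (by decide) (by decide) (by decide)
    (by decide) hlenB hlenC hlenA hn₂ hn₃ hn₁ h6) fun s₁ hf₁ h₁ => ?_
  refine wp_seq_frame (R := fun s' => s'.reg Reg.one = 1) rfl fun s₂ hf₂ hone => ?_
  have hbase : s₂.reg Reg.base = n₂ * n₃ := (hf₂.reg rfl).trans h₁.base
  have hlenA₂ : s₂.reg Reg.lenA = n₁ := (hf₂.reg rfl).trans ((hf₁.reg rfl).trans hlenA)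
  have h7' : s₂.arr 7 = 0 := (hf₂.arr rfl).trans ((hf₁.arr rfl).trans h7)
  refine wp_frame (wp_fill (by decide) (by decide) (by decide) (by decide) (by decide)
    (by decide) hbase hlenA₂ hone hn₂₃ hn₁ hn h7') fun s₃ _ h₃ => ?_
  obtain ⟨-, hle₁, hto₁, hlack₁⟩ := h₁
  obtain ⟨-, hle₃, hto₃, hlack₃⟩ := h₃
  have hlack₂ : s₂.reg Reg.lack = s₁.reg Reg.lack := hf₂.reg rfl
  have h6₂ : s₂.arr 6 = s₁.arr 6 := hf₂.arr rfl
  have h0₂ : s₂.arr 0 = s.arr 0 := (hf₂.arr rfl).trans (hf₁.arr rfl)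
  rw [hlack] at hle₁ hto₁ hlack₁
  rw [h0₂, h6₂, hlack₂] at hto₃ hlack₃
  refine ⟨fun h => ⟨_, hto₁ (by omega), hto₃ (by omega)⟩, fun hsol hsol' => ?_⟩
  have hlack' := hlack₁ hsol
  exact (hlack₃ (hsol' _ (hto₁ hlack'))).trans hlack'

theorem State.outputs_ofIncidence {f : ℕ → ℕ} (h : s.edgeList = support n₁ n₃ f (n₂ * n₃ * n₁)) :
    s.Outputs (PartiteHypergraph.ofIncidence n₁ n₂ n₃ (rowMajor n₁ f)) := by
  refine ⟨h ▸ nodup_support n₁ n₃ f _, fun x y z => ?_⟩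
  rw [h, mem_support_mul]
  simp only [PartiteHypergraph.mem_ofIncidence, exists_prop, and_assoc]

/-- A correct output for `D`. -/
def State.Solves (s : State) (D : DegreeSequence n₁ n₂ n₃) : Prop :=
  (D.Graphic → s.Accepts ∧ ∃ H : PartiteHypergraph n₁ n₂ n₃, H.IsRealization D ∧ s.Outputs H) ∧
    (¬ D.Graphic → s.Rejects)

theorem Distributed.solves {s' : State}
    (h : Distributed n₁ n₂ n₃ (extendZero D.dA) (extendZero D.dB) (extendZero D.dC) s)
    (hreg : D.ThirdAlmostRegular) (hanswer : s'.reg Reg.answer = 1 - s.reg Reg.lack)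
    (hlist : s'.edgeList = support n₁ n₃ (s.arr 7) (n₂ * n₃ * n₁)) : s'.Solves D := by
  have hrealization (h0 : s.reg Reg.lack = 0) :=
    let ⟨_, hm, hM⟩ := h.exists_codegree h0
    PartiteHypergraph.isRealization_ofIncidence hm hM
  refine ⟨fun hD => ?_, fun hD => ?_⟩
  · obtain ⟨H, hH⟩ := id hD
    have h0 : s.reg Reg.lack = 0 := h.lack_eq_zero hD.exists_isTransport fun m =>
      hreg.exists_isTransport hH.sum_dB
    rw [h0] at hanswer
    exact ⟨hanswer, _, hrealization h0, State.outputs_ofIncidence hlist⟩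
  · have h0 : s.reg Reg.lack ≠ 0 := fun h0 => hD ⟨_, hrealization h0⟩
    exact hanswer.trans (by omega)

theorem wp_realize (hreg : D.ThirdAlmostRegular) (hn₁ : n₁ ≤ n) (hn₂ : n₂ ≤ n) (hn₃ : n₃ ≤ n)
    (hn₂₃ : n₂ * n₃ ≤ n) (hn : 1 ≤ n) : realize.wp n (State.Solves · D) (input D) := by
  refine wp_seq_frame (wp_distribute rfl rfl rfl rfl rfl rfl hn₁ hn₂ hn₃ hn₂₃ hn)
    fun s₁ hs₁ h₁ => ?_
  refine wp_seq_frame (wp_emit (hs₁.reg rfl) (hs₁.reg rfl) (hs₁.reg rfl) hn₁ hn₂ hn₃ rfl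
    (hs₁.reg rfl)) fun s₂ hs₂ h₂ => ?_
  refine Distributed.solves h₁ hreg ?_ ?_
  · have hlack : s₂.reg Reg.lack = s₁.reg Reg.lack := hs₂.reg rfl
    simp [hlack]
  · rw [State.edgeList_setReg (by decide), State.edgeList_setReg (by decide), h₂]
    rfl

end Realize

end RAM

namespace DegreeSequence

variable {n₁ n₂ n₃ : ℕ}

theorem length_le_bitLength (D : DegreeSequence n₁ n₂ n₃) : n₁ + n₂ + n₃ ≤ D.bitLength := by
  simp only [bitLength, sum_add_distrib, sum_const, card_univ, Fintype.card_fin, smul_eq_mul,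
    mul_one]
  omega

end DegreeSequence

theorem size_extendZero_le {n : ℕ} (d : Fin n → ℕ) (i : ℕ) :
    Nat.size (extendZero d i) ≤ ∑ i, (Nat.size (d i) + 1) := by
  rw [extendZero]
  split_ifs with h
  · exact (Nat.le_succ _).trans
      (single_le_sum (f := fun i => Nat.size (d i) + 1) (fun _ _ => Nat.zero_le _) (mem_univ _))
  · simp

namespace RAM

variable {n₁ n₂ n₃ : ℕ}

theorem sizeLE_input (D : DegreeSequence n₁ n₂ n₃) : (input D).SizeLE D.bitLength := by
  have hlen := D.length_le_bitLength
  refine ⟨fun x => (Nat.size_le.2 Nat.lt_two_pow_self).trans ?_, fun a i => ?_⟩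
  · simp only [input]
    split_ifs <;> omega
  · change Nat.size (if a = 0 then extendZero D.dA i else if a = 1 then extendZero D.dB i
      else if a = 2 then extendZero D.dC i else 0) ≤ _
    have hA := size_extendZero_le D.dA i
    have hB := size_extendZero_le D.dB i
    have hC := size_extendZero_le D.dC i
    rw [DegreeSequence.bitLength]
    split_ifs
    · omega
    · omega
    · omega
    · simp

end RAM

theorem mainTheorem2 :
    ∃ (P : RAM.Prog) (p : Polynomial ℕ),
      ∀ (n₁ n₂ n₃ : ℕ) (D : DegreeSequence n₁ n₂ n₃), D.ThirdAlmostRegular →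
        ∃ (t : ℕ) (s : RAM.State),
          RAM.Exec P (RAM.input D) t s ∧ t ≤ p.eval D.bitLength ∧
          (D.Graphic → s.Accepts ∧
            ∃ H : PartiteHypergraph n₁ n₂ n₃, H.IsRealization D ∧ s.Outputs H) ∧
          (¬ D.Graphic → s.Rejects) := by
  let K : Polynomial ℕ := RAM.realize.steps.comp (Polynomial.X ^ 2 + 1)
  refine ⟨RAM.realize, K * (2 * (Polynomial.X + K) + 1), fun n₁ n₂ n₃ D hreg => ?_⟩
  have hlen := D.length_le_bitLength
  set N := D.bitLength
  have hruns := RAM.Prog.runs_of_wp <| RAM.wp_realize hreg (n := N ^ 2 + 1)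
    (by nlinarith) (by nlinarith) (by nlinarith) (by nlinarith) (by omega)
  obtain ⟨t, s, hexec, ht, -, hs⟩ := hruns N (RAM.sizeLE_input D)
  exact ⟨t, s, hexec, by simpa [K] using ht, hs⟩
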